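/- Let $d \ge 2$ be a fixed integer. For $n$ with $dn$ even, let $G_{n,d}$ be a uniformly random $d$-regular simple graph on the vertex set $\{1,\dots,n\}$, and let $\gamma(G)$ denote the orientable genus of a graph $G$, that is, the smallest $g \ge 0$ such that $G$ can be drawn without edge crossings on the sphere with $g$ handles. Then for every $\varepsilon > 0$, $$\Pr\left[(1-\varepsilon)\,\frac{(d-2)n}{4} \;\le\; \gamma(G_{n,d}) \;\le\; (1+\varepsilon)\,\frac{(d-2)n}{4}\right] \longrightarrow 1$$ as $n \to \infty$ through the integers with $dn$ even. (For $d = 2$ this says that $\gamma(G_{n,2}) = 0$ with probability tending to $1$.) -/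

import Mathlib

open Filter Topology

/-- A cellular decomposition of a closed connected oriented surface, encoded as a combinatorial
oriented map. `Dart` is the set of oriented edges (1-cells with a direction), `rev` reverses the
direction, and `rot` sends a dart to the next one, in the positive sense, among the darts that
leave the same vertex. -/
structure CellSurface where
  Dart : Type
  [fintypeDart : Fintype Dart]
  [decEqDart : DecidableEq Dart]
  [nonemptyDart : Nonempty Dart]
  rot : Equiv.Perm Dart
  rev : Equiv.Perm Dart
  rev_rev : ∀ a, rev (rev a) = a
  rev_ne : ∀ a, rev a ≠ a
  connected : ∀ a b, ∃ τ ∈ Subgroup.closure {rot, rev}, τ a = b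

namespace CellSurface

attribute [instance] fintypeDart decEqDart nonemptyDart

variable (S : CellSurface)

/-- The 0-cells: the cycles of `rot`, fixed points included. -/
def Vertex : Type := Quotient (Equiv.Perm.SameCycle.setoid S.rot)

/-- The 1-cells: the pairs of mutually reverse darts. -/
def Edge : Type := Quotient (Equiv.Perm.SameCycle.setoid S.rev)

/-- The 2-cells: the cycles of the permutation that walks along a dart and then turns to the next
dart at the vertex reached, that is, the boundary walks of the 2-cells. -/
def Face : Type := Quotient (Equiv.Perm.SameCycle.setoid (S.rot * S.rev))

/-- The vertex that a dart leaves. -/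
def source (a : S.Dart) : S.Vertex := Quotient.mk (Equiv.Perm.SameCycle.setoid S.rot) a

/-- The surface is the sphere with `g` handles: its Euler characteristic is `2 - 2g`. -/
def HasGenus (g : ℕ) : Prop :=
  (Nat.card S.Vertex : ℤ) - Nat.card S.Edge + Nat.card S.Face = 2 - 2 * g

end CellSurface

namespace SimpleGraph

/-- A drawing without crossings of a graph on a surface, presented by a cellular decomposition
that contains it: distinct vertices of the graph are distinct 0-cells, distinct edges are distinct
1-cells with the right ends. The decomposition may have further cells, so the faces of the drawing
itself need not be discs and the graph need not be connected. -/
structure Drawing {V : Type*} (G : SimpleGraph V) (S : CellSurface) where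
  vert : V → S.Vertex
  vert_injective : Function.Injective vert
  dart : G.Dart → S.Dart
  dart_injective : Function.Injective dart
  dart_symm : ∀ a : G.Dart, dart a.symm = S.rev (dart a)
  source_dart : ∀ a : G.Dart, S.source (dart a) = vert a.fst

/-- The orientable genus of a graph: the smallest `g` such that the graph can be drawn without
crossings on the sphere with `g` handles. -/
noncomputable def genus {V : Type*} (G : SimpleGraph V) : ℕ :=
  sInf {g : ℕ | ∃ S : CellSurface, S.HasGenus g ∧ Nonempty (G.Drawing S)}

end SimpleGraph

open scoped Classical in
/-- The `d`-regular simple graphs on the vertex set `Fin n`. -/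
def regularGraphs (n d : ℕ) : Set (SimpleGraph (Fin n)) :=
  {G | G.IsRegularOfDegree d}

/-- The probability that a uniformly random `d`-regular graph on `Fin n` has the property `P`. -/
noncomputable def regularGraphProb (n d : ℕ) (P : SimpleGraph (Fin n) → Prop) : ℝ :=
  ({G ∈ regularGraphs n d | P G}.ncard : ℝ) / ((regularGraphs n d).ncard : ℝ)

open Equiv Equiv.Perm

/-! The source of the estimate is Euler's formula. A drawing of `G` on a surface of genus `g`
satisfies `2|E| ≤ 4g + 2|V| + 2F`, where `F` counts the faces that meet an edge of `G`. In a
`d`-regular graph `2|E| = dn`, so `g` is close to `(d-2)n/4` as soon as `F` and the number of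
components are `o(n)`.

Lower bound. `twiceGenus` is defined for disconnected maps, and `twiceGenus_mono` says that deleting
edges cannot increase it; restricting the reversal of the surface to the darts of `G` gives the
inequality (`ncard_le_of_submap`). When all degrees are at least 2, the edges along a face form a
graph without leaves, which contains a cycle. Hence a face has at least `L` darts or touches an edge
on a short cycle, and `F` is at most `|Darts|/L` plus the number of such oriented edges
(`Drawing.card_dart_le`).

Upper bound. Any choice of rotations will do: a hub vertex joined once to each component makes the
map connected, and a single face already yields `4g + 2|V| ≤ |Darts| + 2c`, with `c` the number of
components (`exists_drawing`). Small components contain short cycles, so `c` is small for the same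
reason as `F`. For `d = 2` this is not exact enough, and the faces of the cycles are counted to get
genus 0.

Randomness enters only through short cycles. Switching an edge on a short cycle with a distant edge
is injective once the two edges are recorded, and double counting bounds the mean number of edges on
short cycles independently of `n` (`mul_sum_ncard_shortCyclePairs_le`). Markov's inequality finishes
the proof. -/

/-- The number of classes of an equivalence relation. -/
noncomputable def Setoid.numClasses {D : Type*} (r : Setoid D) : ℕ := Nat.card (Quotient r)

/-! ### Cycle relations and their number of classes -/

section Setoids

variable {D : Type*}

theorem Equiv.Perm.cycleSetoid_le {π : Perm D} {r : Setoid D} (h : ∀ x, r x (π x)) :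
    SameCycle.setoid π ≤ r := by
  rintro x y ⟨i, rfl⟩
  induction i with
  | zero => exact r.refl _
  | succ i ih =>
    rw [add_comm, zpow_one_add]
    exact r.trans ih (h _)
  | pred i ih =>
    refine r.trans ih (r.symm ?_)
    have := h ((π ^ (-(i : ℤ) - 1)) x)
    rwa [← Perm.mul_apply, ← zpow_one_add, add_sub_cancel] at this

theorem Equiv.Perm.cycleSetoid_apply (π : Perm D) (x : D) : SameCycle.setoid π x (π x) :=
  ⟨1, by simp⟩

theorem Equiv.Perm.cycleSetoid_mul_le (π τ : Perm D) :
    SameCycle.setoid (π * τ) ≤ SameCycle.setoid π ⊔ SameCycle.setoid τ := by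
  refine cycleSetoid_le fun x => ?_
  refine (SameCycle.setoid π ⊔ SameCycle.setoid τ).trans (b := τ x) ?_ ?_
  · exact (le_sup_right : SameCycle.setoid τ ≤ _) (cycleSetoid_apply τ x)
  · exact (le_sup_left : SameCycle.setoid π ≤ _) (cycleSetoid_apply π (τ x))

theorem Setoid.numClasses_le_of_surjective [Finite D] {r : Setoid D} {X : Type*} (f : D → X)
    (hf : Function.Surjective f) (h : ∀ x y, r x y → f x = f y) : Nat.card X ≤ r.numClasses := by
  refine Nat.card_le_card_of_surjective (Quotient.lift f h) fun x => ?_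
  obtain ⟨a, rfl⟩ := hf x
  exact ⟨Quotient.mk _ a, rfl⟩

/-- The tool for bounding vertices and faces from below: an invariant of `π` takes one value per
cycle. -/
theorem Equiv.Perm.card_le_numClasses [Finite D] {π : Perm D} {X : Type*} (f : D → X)
    (hf : Function.Surjective f) (h : ∀ x, f (π x) = f x) :
    Nat.card X ≤ (SameCycle.setoid π).numClasses := by
  refine Setoid.numClasses_le_of_surjective f hf fun x y hxy => ?_
  exact (cycleSetoid_le (r := Setoid.ker f) (fun x => (h x).symm)) hxy

theorem Setoid.numClasses_bot : (⊥ : Setoid D).numClasses = Nat.card D := by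
  refine (Nat.card_congr (Equiv.ofBijective (Quotient.mk (⊥ : Setoid D)) ⟨?_, ?_⟩)).symm
  · intro a b h
    exact Quotient.exact h
  · exact Quotient.mk_surjective

theorem Setoid.numClasses_top [Nonempty D] : (⊤ : Setoid D).numClasses = 1 := by
  have : Subsingleton (Quotient (⊤ : Setoid D)) := by
    refine ⟨fun a b => ?_⟩
    induction a, b using Quotient.inductionOn₂
    exact Quotient.sound trivial
  have : Nonempty (Quotient (⊤ : Setoid D)) := ⟨Quotient.mk _ (Classical.arbitrary D)⟩
  exact Nat.card_unique

theorem Equiv.Perm.cycleSetoid_one : SameCycle.setoid (1 : Perm D) = ⊥ := by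
  refine le_bot_iff.1 (cycleSetoid_le fun x => ?_)
  rfl

/-- Twice the genus of the (possibly disconnected) oriented map with vertices the cycles of `σ`
and edges the cycles of `α`. -/
noncomputable def twiceGenus (σ α : Perm D) : ℤ :=
  Nat.card D + 2 * (SameCycle.setoid σ ⊔ SameCycle.setoid α).numClasses
    - (SameCycle.setoid σ).numClasses - (SameCycle.setoid α).numClasses
    - (SameCycle.setoid (σ * α)).numClasses

theorem twiceGenus_one (σ : Perm D) : twiceGenus σ 1 = 0 := by
  rw [twiceGenus, cycleSetoid_one, sup_bot_eq, mul_one, Setoid.numClasses_bot]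
  ring

theorem Equiv.Perm.not_sameCycle_of_fixed {α : Perm D} {a b : D} (hab : a ≠ b) (ha : α a = a) :
    ¬ SameCycle α a b := by
  rintro ⟨i, hi⟩
  rw [zpow_apply_eq_self_of_apply_eq_self ha] at hi
  exact hab hi

/-! ### Gluing two classes, and multiplication by a transposition -/

variable [DecidableEq D]

/-- Gluing the classes of `a` and `b`. -/
def Setoid.glue (r : Setoid D) (a b : D) : Setoid D := r ⊔ SameCycle.setoid (swap a b)

theorem Setoid.le_glue (r : Setoid D) (a b : D) : r ≤ r.glue a b := le_sup_left

theorem Setoid.glue_rel (r : Setoid D) (a b : D) : r.glue a b a b :=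
  (le_sup_right : SameCycle.setoid (swap a b) ≤ _) ⟨1, by simp⟩

theorem Setoid.glue_le {r s : Setoid D} {a b : D} (h : r ≤ s) (hab : s a b) : r.glue a b ≤ s := by
  refine sup_le h (cycleSetoid_le fun x => ?_)
  by_cases hxa : x = a
  · subst hxa; simpa using hab
  by_cases hxb : x = b
  · subst hxb; simpa using s.symm hab
  rw [swap_apply_of_ne_of_ne hxa hxb]

theorem Setoid.glue_eq {r : Setoid D} {a b : D} (h : r a b) : r.glue a b = r :=
  le_antisymm (glue_le le_rfl h) (r.le_glue a b)

theorem Setoid.glue_iff (r : Setoid D) (a b x y : D) :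
    r.glue a b x y ↔ r x y ∨ (r x a ∧ r b y) ∨ (r x b ∧ r a y) := by
  constructor
  · let s : Setoid D :=
      { r := fun x y => r x y ∨ (r x a ∧ r b y) ∨ (r x b ∧ r a y)
        iseqv :=
          { refl := fun x => Or.inl (r.refl x)
            symm := by
              rintro x y (h | ⟨h, h'⟩ | ⟨h, h'⟩)
              · exact Or.inl (r.symm h)
              · exact Or.inr (Or.inr ⟨r.symm h', r.symm h⟩)
              · exact Or.inr (Or.inl ⟨r.symm h', r.symm h⟩)
            trans := by
              rintro x y z (h | ⟨h, h'⟩ | ⟨h, h'⟩) (k | ⟨k, k'⟩ | ⟨k, k'⟩)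
              · exact Or.inl (r.trans h k)
              · exact Or.inr (Or.inl ⟨r.trans h k, k'⟩)
              · exact Or.inr (Or.inr ⟨r.trans h k, k'⟩)
              · exact Or.inr (Or.inl ⟨h, r.trans h' k⟩)
              · exact Or.inr (Or.inl ⟨h, k'⟩)
              · exact Or.inl (r.trans h k')
              · exact Or.inr (Or.inr ⟨h, r.trans h' k⟩)
              · exact Or.inl (r.trans h k')
              · exact Or.inr (Or.inr ⟨h, k'⟩) } }
    have : r.glue a b ≤ s := glue_le (fun _ _ h => Or.inl h) (Or.inr (Or.inl ⟨r.refl _, r.refl _⟩))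
    exact fun h => this h
  · rintro (h | ⟨h, h'⟩ | ⟨h, h'⟩)
    · exact r.le_glue a b h
    · exact (r.glue a b).trans (r.le_glue a b h)
        ((r.glue a b).trans (r.glue_rel a b) (r.le_glue a b h'))
    · exact (r.glue a b).trans (r.le_glue a b h)
        ((r.glue a b).trans ((r.glue a b).symm (r.glue_rel a b)) (r.le_glue a b h'))

/-- The classes other than that of `a` are in bijection with the classes after gluing; the class of
`b` stands for the merged one. -/
theorem Setoid.numClasses_glue [Finite D] {r : Setoid D} {a b : D} (h : ¬ r a b) :
    r.numClasses = (r.glue a b).numClasses + 1 := by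
  classical
  have e : Nat.card {q : Quotient r // q ≠ Quotient.mk r a} = (r.glue a b).numClasses := by
    refine Nat.card_congr (Equiv.ofBijective
      (fun q => Quotient.map' (s₂ := r.glue a b) id (fun x y hxy => r.le_glue a b hxy) q.1) ⟨?_, ?_⟩)
    · rintro ⟨q, hq⟩ ⟨q', hq'⟩ hqq
      induction q, q' using Quotient.inductionOn₂ with
      | _ x y =>
      have hxy : r.glue a b x y := Quotient.exact hqq
      rw [glue_iff] at hxy
      rcases hxy with hxy | ⟨hxy, -⟩ | ⟨-, hxy⟩
      · exact Subtype.ext (Quotient.sound hxy)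
      · exact absurd (Quotient.sound hxy) hq
      · exact absurd (Quotient.sound (r.symm hxy)) hq'
    · intro q
      induction q using Quotient.inductionOn with
      | _ x =>
      by_cases hx : r x a
      · refine ⟨⟨Quotient.mk r b, fun hb => h (r.symm (Quotient.exact hb))⟩, ?_⟩
        refine Quotient.sound ?_
        exact (r.glue a b).trans ((r.glue a b).symm (r.glue_rel a b))
          ((r.glue a b).symm (r.le_glue a b hx))
      · exact ⟨⟨Quotient.mk r x, fun hb => hx (Quotient.exact hb)⟩, rfl⟩
  have : Fintype (Quotient r) := Fintype.ofFinite _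
  rw [← e, Setoid.numClasses, Nat.card_eq_fintype_card, Nat.card_eq_fintype_card,
    Fintype.card_subtype_compl, Fintype.card_subtype_eq]
  have : 0 < Fintype.card (Quotient r) := Fintype.card_pos_iff.2 ⟨Quotient.mk r a⟩
  omega

/-- Right multiplication by a transposition does not change the relation with `a`, `b` glued. -/
theorem Equiv.Perm.glue_cycleSetoid_mul_swap (π : Perm D) (a b : D) :
    (SameCycle.setoid (π * swap a b)).glue a b = (SameCycle.setoid π).glue a b := by
  apply le_antisymm
  · exact Setoid.glue_le (cycleSetoid_mul_le _ _) (Setoid.glue_rel _ a b)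
  · refine Setoid.glue_le ?_ (Setoid.glue_rel _ a b)
    have := cycleSetoid_mul_le (π * swap a b) (swap a b)
    rwa [mul_assoc, swap_mul_self, mul_one] at this

theorem Equiv.Perm.not_sameCycle_mul_swap [Finite D] {π : Perm D} {a b : D} (hab : a ≠ b)
    (h : SameCycle π a b) : ¬ SameCycle (π * swap a b) a b := by
  classical
  obtain ⟨m, hm⟩ : ∃ m : ℕ, (π ^ m) a = b := by
    obtain ⟨m, -, -, hm⟩ := h.exists_pow_eq''
    exact ⟨m, hm⟩
  have hex : ∃ m : ℕ, (π ^ m) a = b := ⟨m, hm⟩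
  let k := Nat.find hex
  have hk : (π ^ k) a = b := Nat.find_spec hex
  have hmin : ∀ j < k, (π ^ j) a ≠ b := fun j hj => Nat.find_min hex hj
  have hna : ∀ j, 0 < j → j ≤ k → (π ^ j) a ≠ a := by
    intro j hj hjk hja
    refine hmin (k - j) (by omega) ?_
    have : (π ^ (k - j)) ((π ^ j) a) = b := by
      rw [← Perm.mul_apply, ← pow_add, Nat.sub_add_cancel hjk, hk]
    rwa [hja] at this
  have hk0 : 0 < k := by
    rcases Nat.eq_zero_or_pos k with h0 | h0
    · rw [h0] at hk; exact absurd hk hab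
    · exact h0
  -- The arc `π a, …, π ^ k a = b`. It is closed under `π * swap a b`, which sends `b` back to `π
  -- a`; it contains `b` but not `a`.
  let U : Set D := {x | ∃ j, 0 < j ∧ j ≤ k ∧ (π ^ j) a = x}
  have hU : ∀ x ∈ U, (π * swap a b) x ∈ U := by
    rintro x ⟨j, hj, hjk, rfl⟩
    rcases hjk.lt_or_eq with hlt | rfl
    · refine ⟨j + 1, by omega, by omega, ?_⟩
      rw [Perm.mul_apply, swap_apply_of_ne_of_ne (hna j hj hjk) (hmin j hlt), pow_succ',
        Perm.mul_apply]
    · refine ⟨1, by omega, by omega, ?_⟩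
      rw [hk]; simp
  intro hs
  obtain ⟨n, -, -, hn⟩ := hs.symm.exists_pow_eq''
  have hmem : ∀ n : ℕ, ((π * swap a b) ^ n) b ∈ U := by
    intro n
    induction n with
    | zero => exact ⟨k, hk0, le_rfl, hk⟩
    | succ n ih => rw [pow_succ', Perm.mul_apply]; exact hU _ ih
  obtain ⟨j, hj, hjk, hja⟩ := hmem n
  exact hna j hj hjk (hja.trans hn)

/-- The new permutation sends `a` to `π b` and then follows the old cycle of `b`, which never meets
`a`, until it reaches `b`. -/
theorem Equiv.Perm.sameCycle_mul_swap [Finite D] {π : Perm D} {a b : D}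
    (h : ¬ SameCycle π a b) : SameCycle (π * swap a b) a b := by
  classical
  have hex : ∃ k : ℕ, 0 < k ∧ (π ^ k) b = b := by
    obtain ⟨k, hk, -, h⟩ := (SameCycle.refl π b).exists_pow_eq''
    exact ⟨k, hk, h⟩
  let k := Nat.find hex
  obtain ⟨hk0, hk⟩ : 0 < k ∧ (π ^ k) b = b := Nat.find_spec hex
  have hmin : ∀ j < k, 0 < j → (π ^ j) b ≠ b := fun j hj h0 h => Nat.find_min hex hj ⟨h0, h⟩
  have key : ∀ j : ℕ, 0 < j → j ≤ k → ((π * swap a b) ^ j) a = (π ^ j) b := by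
    intro j
    induction j with
    | zero => intro h0; omega
    | succ j ih =>
      intro _ hjk
      rcases Nat.eq_zero_or_pos j with rfl | hj
      · simp
      · rw [pow_succ', Perm.mul_apply, ih hj (by omega), Perm.mul_apply,
          swap_apply_of_ne_of_ne _ (hmin j (by omega) hj), pow_succ', Perm.mul_apply]
        intro hja
        exact h (SameCycle.symm ⟨j, by simpa using hja⟩)
  exact ⟨k, by rw [zpow_natCast, key k hk0 le_rfl, hk]⟩

/-- Right multiplication by a transposition joins two cycles or splits one. -/
theorem Equiv.Perm.numClasses_mul_swap_of_not_sameCycle [Finite D] {π : Perm D} {a b : D}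
    (h : ¬ SameCycle π a b) : (SameCycle.setoid π).numClasses =
      (SameCycle.setoid (π * swap a b)).numClasses + 1 := by
  rw [Setoid.numClasses_glue (r := SameCycle.setoid π) h, ← glue_cycleSetoid_mul_swap,
    Setoid.glue_eq (r := SameCycle.setoid (π * swap a b)) (sameCycle_mul_swap h)]

theorem Equiv.Perm.numClasses_mul_swap_of_sameCycle [Finite D] {π : Perm D} {a b : D}
    (hab : a ≠ b) (h : SameCycle π a b) : (SameCycle.setoid (π * swap a b)).numClasses =
      (SameCycle.setoid π).numClasses + 1 := by
  rw [Setoid.numClasses_glue (r := SameCycle.setoid (π * swap a b)) (not_sameCycle_mul_swap hab h),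
    glue_cycleSetoid_mul_swap, Setoid.glue_eq (r := SameCycle.setoid π) h]

/-! ### The genus under addition of edges -/

/-- Adding an edge does not decrease the genus and does not change the parity. -/
theorem twiceGenus_mul_swap [Finite D] (σ : Perm D) {α : Perm D} {a b : D} (hab : a ≠ b)
    (ha : α a = a) : twiceGenus σ (α * swap a b) = twiceGenus σ α ∨
      twiceGenus σ (α * swap a b) = twiceGenus σ α + 2 := by
  have h1 := numClasses_mul_swap_of_not_sameCycle (not_sameCycle_of_fixed hab ha)
  have h2 : SameCycle.setoid σ ⊔ SameCycle.setoid (α * swap a b) =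
      (SameCycle.setoid σ ⊔ SameCycle.setoid α).glue a b := by
    have h3 : SameCycle.setoid (α * swap a b) = (SameCycle.setoid α).glue a b := by
      rw [← glue_cycleSetoid_mul_swap, Setoid.glue_eq]
      exact sameCycle_mul_swap (not_sameCycle_of_fixed hab ha)
    rw [h3, Setoid.glue, Setoid.glue, sup_assoc]
  -- Within a component the new edge either splits a face, keeping the genus, or joins two faces,
  -- adding a handle. Between two components it merges two components and two faces, which cancel.
  by_cases ho : (SameCycle.setoid σ ⊔ SameCycle.setoid α) a b
  · rw [Setoid.glue_eq ho] at h2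
    rw [twiceGenus, twiceGenus, h2, ← mul_assoc]
    by_cases hf : SameCycle (σ * α) a b
    · have := numClasses_mul_swap_of_sameCycle hab hf
      left; omega
    · have := numClasses_mul_swap_of_not_sameCycle hf
      right; omega
  · have h3 := Setoid.numClasses_glue ho
    have hf : ¬ SameCycle (σ * α) a b := fun hf => ho (cycleSetoid_mul_le σ α hf)
    have := numClasses_mul_swap_of_not_sameCycle hf
    rw [twiceGenus, twiceGenus, h2, ← mul_assoc]
    left; omega

/-- Induction on involutions: from a restriction `β` of `α` one arrives at `α` by multiplying with
transpositions of fixed points. -/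
theorem involution_induction [Finite D] {β : Perm D} (hβ : ∀ x, β (β x) = x)
    {p : Perm D → Prop} (base : p β)
    (step : ∀ (α : Perm D) (a b : D), a ≠ b → α a = a → α b = b → p α → p (α * swap a b))
    (α : Perm D) (hα : ∀ x, α (α x) = x) (h : ∀ x, β x = α x ∨ β x = x) : p α := by
  classical
  have : Fintype D := Fintype.ofFinite D
  induction hn : (Finset.univ.filter fun x => β x ≠ α x).card using Nat.strong_induction_on
    generalizing α with
  | _ n ih =>
  by_cases he : ∀ x, β x = α x
  · rwa [← Equiv.ext he]
  push Not at he
  obtain ⟨a, ha⟩ := he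
  have hβa : β a = a := (h a).resolve_left ha
  have hab : a ≠ α a := fun e => ha (hβa.trans e)
  have hβb : β (α a) = α a := by
    rcases h (α a) with hb | hb
    · rw [hα] at hb
      have := hβ (α a)
      rw [hb, hβa] at this
      exact absurd this hab
    · exact hb
  -- One 2-cycle of `α` on which `β` is trivial is removed, so `α'` differs from `β` at fewer
  -- points.
  set α' := α * swap a (α a) with hα'
  have ha' : α' a = a := by simp [hα', hα]
  have hb' : α' (α a) = α a := by simp [hα']
  have hx' : ∀ x, x ≠ a → x ≠ α a → α' x = α x := fun x h1 h2 => by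
    rw [hα', Perm.mul_apply, swap_apply_of_ne_of_ne h1 h2]
  have hp : p α' := by
    refine ih _ ?_ α' ?_ ?_ rfl
    · rw [← hn]
      refine Finset.card_lt_card ⟨?_, ?_⟩
      · intro x hx
        simp only [Finset.mem_filter, Finset.mem_univ, true_and] at hx ⊢
        by_cases h1 : x = a
        · exact absurd (h1 ▸ hβa.trans ha'.symm) hx
        by_cases h2 : x = α a
        · exact absurd (h2 ▸ hβb.trans hb'.symm) hx
        rwa [hx' x h1 h2] at hx
      · intro hs
        have := hs (x := a) (by simpa using ha)
        simp [ha', hβa] at this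
    · intro x
      by_cases h1 : x = a
      · rw [h1, ha', ha']
      by_cases h2 : x = α a
      · rw [h2, hb', hb']
      rw [hx' x h1 h2, hx' _ (fun e => h2 (by rw [← e, hα])) (fun e => h1 (α.injective e)), hα]
    · intro x
      by_cases h1 : x = a
      · right; rw [h1, hβa]
      by_cases h2 : x = α a
      · right; rw [h2, hβb]
      rw [hx' x h1 h2]; exact h x
  have := step α' a (α a) hab ha' hb' hp
  rwa [hα', mul_assoc, swap_mul_self, mul_one] at this

theorem twiceGenus_mono [Finite D] (σ : Perm D) {α β : Perm D} (hα : ∀ x, α (α x) = x)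
    (hβ : ∀ x, β (β x) = x) (h : ∀ x, β x = α x ∨ β x = x) :
    twiceGenus σ β ≤ twiceGenus σ α := by
  refine involution_induction hβ (p := fun α => twiceGenus σ β ≤ twiceGenus σ α) le_rfl ?_ α hα h
  intro α a b hab ha _ hp
  have := twiceGenus_mul_swap σ hab ha
  omega

theorem exists_twiceGenus_eq [Finite D] (σ : Perm D) {α : Perm D} (hα : ∀ x, α (α x) = x) :
    ∃ g : ℕ, twiceGenus σ α = 2 * g := by
  refine involution_induction (β := 1) (fun _ => rfl)
    (p := fun α => ∃ g : ℕ, twiceGenus σ α = 2 * g) ⟨0, by simp [twiceGenus_one]⟩ ?_ α hα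
    fun x => Or.inr rfl
  rintro α a b hab ha _ ⟨g, hg⟩
  rcases twiceGenus_mul_swap σ hab ha with h | h
  · exact ⟨g, h.trans hg⟩
  · exact ⟨g + 1, by rw [h, hg]; push_cast; ring⟩

/-- Each added transposition costs one class and two fixed points. -/
theorem two_mul_numClasses_involution [Finite D] {α : Perm D} (hα : ∀ x, α (α x) = x) :
    2 * (SameCycle.setoid α).numClasses = Nat.card D + {x | α x = x}.ncard := by
  refine involution_induction (β := 1) (fun _ => rfl)
    (p := fun α => 2 * (SameCycle.setoid α).numClasses = Nat.card D + {x | α x = x}.ncard)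
    ?_ ?_ α hα fun x => Or.inr rfl
  · rw [cycleSetoid_one, Setoid.numClasses_bot]
    simp [Set.ncard_univ, two_mul]
  · intro α a b hab ha hb hp
    have h1 := numClasses_mul_swap_of_not_sameCycle (not_sameCycle_of_fixed hab ha)
    have h2 : {x | α x = x} = insert a (insert b {x | (α * swap a b) x = x}) := by
      ext x
      simp only [Set.mem_ofPred_eq, Set.mem_insert_iff]
      by_cases hxa : x = a
      · simp [hxa, ha]
      by_cases hxb : x = b
      · simp [hxb, hb]
      simp [hxa, hxb, swap_apply_of_ne_of_ne hxa hxb]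
    rw [h2, Set.ncard_insert_of_notMem, Set.ncard_insert_of_notMem] at hp
    · omega
    · simp [ha, hab]
    · simp [hb, hab, hab.symm]

end Setoids

/-! ### Short cycles in graphs without leaves -/

namespace SimpleGraph

variable {V : Type*}

/-- The oriented edges `(a, b)` that lie on a cycle of length at most `k + 1`. -/
def shortCyclePairs (G : SimpleGraph V) (k : ℕ) : Set (V × V) :=
  {p | G.Adj p.1 p.2 ∧ ∃ w : (G.deleteEdges {s(p.1, p.2)}).Walk p.1 p.2, w.length ≤ k}

theorem swap_mem_shortCyclePairs {G : SimpleGraph V} {k : ℕ} {a b : V}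
    (h : (a, b) ∈ G.shortCyclePairs k) : (b, a) ∈ G.shortCyclePairs k := by
  obtain ⟨h, w, hw⟩ := h
  refine ⟨h.symm, ?_⟩
  have e : s(b, a) = s(a, b) := Sym2.eq_swap
  change ∃ w : (G.deleteEdges {s(b, a)}).Walk b a, w.length ≤ k
  rw [e]
  exact ⟨w.reverse, by simpa using hw⟩

/-- In a forest a path can be prolonged by any neighbour of its end except the penultimate vertex,
so without leaves there would be arbitrarily long paths. -/
theorem not_isAcyclic_of_forall_adj [Finite V] {H : SimpleGraph V} {a b : V} (hab : H.Adj a b)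
    (h : ∀ u v, H.Adj u v → ∃ w, w ≠ u ∧ H.Adj v w) : ¬ H.IsAcyclic := by
  classical
  intro hac
  have hpath : ∀ k : ℕ, ∃ v, ∃ p : H.Walk a v, p.IsPath ∧ p.length = k + 1 := by
    intro k
    induction k with
    | zero => exact ⟨b, hab.toWalk, by simp [hab.ne], by simp⟩
    | succ k ih =>
      obtain ⟨v, p, hp, hk⟩ := ih
      have hnil : ¬ p.Nil := by rw [← Walk.length_eq_zero_iff]; omega
      obtain ⟨w, hw, hvw⟩ := h _ _ (p.adj_penultimate hnil)
      have hws : w ∉ p.support := fun hmem => hw (hac.eq_penultimate_of_adj_end hp hvw hmem)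
      exact ⟨w, p.concat hvw, hp.concat hws hvw, by simp [hk]⟩
  have := Fintype.ofFinite V
  obtain ⟨v, p, hp, hk⟩ := hpath (Fintype.card V)
  have := hp.length_lt
  omega

/-- A finite graph without leaves and with at most `k` edges has an edge on a short cycle. -/
theorem exists_mem_shortCyclePairs [Finite V] {G H : SimpleGraph V} (hHG : H ≤ G) {a b : V}
    (hab : H.Adj a b) (h : ∀ u v, H.Adj u v → ∃ w, w ≠ u ∧ H.Adj v w) {k : ℕ}
    (hk : H.edgeSet.ncard ≤ k) : ∃ u v, H.Adj u v ∧ (u, v) ∈ G.shortCyclePairs k := by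
  classical
  have hac := not_isAcyclic_of_forall_adj hab h
  rw [isAcyclic_iff_forall_adj_isBridge] at hac
  push Not at hac
  obtain ⟨u, v, huv, hb⟩ := hac
  rw [isBridge_iff, not_not] at hb
  obtain ⟨p, hp⟩ := hb.exists_isPath
  have hle : H.deleteEdges {s(u, v)} ≤ G.deleteEdges {s(u, v)} := deleteEdges_mono hHG
  refine ⟨u, v, huv, hHG huv, p.mapLe hle, ?_⟩
  rw [Walk.length_mapLe]
  refine le_trans ?_ hk
  have : Fintype (H.deleteEdges {s(u, v)}).edgeSet := Fintype.ofFinite _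
  refine hp.isTrail.length_le_card_edgeFinset.trans ?_
  rw [← Set.ncard_coe_finset, coe_edgeFinset]
  exact Set.ncard_le_ncard (edgeSet_mono (deleteEdges_le _)) (Set.toFinite _)

end SimpleGraph

/-- If every small fibre of `f` meets `B`, then there are few fibres. -/
theorem mul_ncard_range_le {X Q : Type*} [Finite X] (f : X → Q) (B : Set X) (L : ℕ)
    (h : ∀ x, (f ⁻¹' {f x}).ncard < L → ∃ y ∈ B, f y = f x) :
    L * (Set.range f).ncard ≤ Nat.card X + L * B.ncard := by
  classical
  have := Fintype.ofFinite X
  -- The values with large fibres; by disjointness there are at most `|X| / L` of them, and every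
  -- other value is attained on `B`.
  let R : Finset Q := (Finset.univ.image f).filter fun q => L ≤ (f ⁻¹' {q}).ncard
  have hsub : Set.range f ⊆ (R : Set Q) ∪ f '' B := by
    rintro _ ⟨x, rfl⟩
    by_cases hx : L ≤ (f ⁻¹' {f x}).ncard
    · left; simp [R, hx]
    · obtain ⟨y, hy, hyx⟩ := h x (by omega)
      exact Or.inr ⟨y, hy, hyx⟩
  have h1 : (Set.range f).ncard ≤ R.card + B.ncard := by
    refine (Set.ncard_le_ncard hsub (Set.toFinite _)).trans ((Set.ncard_union_le _ _).trans ?_)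
    rw [Set.ncard_coe_finset]
    exact Nat.add_le_add_left (Set.ncard_image_le (Set.toFinite _)) _
  have h2 : R.card * L ≤ Nat.card X := by
    have : ∑ q ∈ R, (Finset.univ.filter fun x => f x = q).card ≤ Nat.card X := by
      rw [← Finset.card_biUnion]
      · rw [Nat.card_eq_fintype_card]; exact Finset.card_le_univ _
      · intro q _ q' _ hqq
        rw [Function.onFun, Finset.disjoint_left]
        simp only [Finset.mem_filter, Finset.mem_univ, true_and]
        rintro x rfl
        exact hqq
    refine le_trans ?_ this
    rw [← smul_eq_mul]
    refine Finset.card_nsmul_le_sum _ _ _ fun q hq => ?_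
    have hq := (Finset.mem_filter.1 hq).2
    rwa [← Set.ncard_coe_finset, show ((Finset.univ.filter fun x => f x = q : Finset X) : Set X)
      = f ⁻¹' {q} by ext; simp]
  calc L * (Set.range f).ncard ≤ L * (R.card + B.ncard) := Nat.mul_le_mul_left _ h1
    _ = R.card * L + L * B.ncard := by ring
    _ ≤ _ := Nat.add_le_add_right h2 _

/-! ### Euler's inequality for submaps -/

section Submap

variable {D : Type*}

/-- The cycles of `π` that avoid `T` are orbits of the group generated by `σ` and `β`. -/
theorem numClasses_le_ncard_add [Finite D] {σ β π : Perm D} {T : Set D}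
    (hπ : ∀ x, x ∉ T → π x = σ x) (hβ : ∀ x, x ∉ T → β x = x) (hT : ∀ x ∈ T, β x ∈ T) :
    (SameCycle.setoid π).numClasses ≤ (Quotient.mk (SameCycle.setoid π) '' T).ncard +
      (SameCycle.setoid σ ⊔ SameCycle.setoid β).numClasses := by
  classical
  -- The union of the cycles of `π` that avoid `T`. There `π` agrees with `σ` and `β` is trivial, so
  -- the map `f` that remembers the cycle on `A` and nothing elsewhere is invariant under both.
  let A : Set D := {x | ∀ y, SameCycle π x y → y ∉ T}
  have hAT : ∀ x ∈ A, x ∉ T := fun x hx => hx x (SameCycle.refl _ _)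
  have hAc : ∀ x y, SameCycle π x y → x ∈ A → y ∈ A := fun x y hxy hx z hz => hx z (hxy.trans hz)
  let f : D → Option (Quotient (SameCycle.setoid π)) := fun x =>
    if x ∈ A then some (Quotient.mk _ x) else none
  have hAσ : ∀ x, σ x ∈ A ↔ x ∈ A := by
    intro x
    constructor
    · intro hx
      have h1 : SameCycle π (σ x) (π⁻¹ (σ x)) := ⟨-1, by simp⟩
      have h2 := hAc _ _ h1 hx
      have h3 := hπ _ (hAT _ h2)
      rw [← Perm.mul_apply, mul_inv_cancel, Perm.one_apply] at h3
      rwa [← σ.injective h3] at h2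
    · intro hx
      rw [← hπ x (hAT x hx)]
      exact hAc _ _ (cycleSetoid_apply π x) hx
  have hfσ : ∀ x, f x = f (σ x) := by
    intro x
    by_cases hx : x ∈ A
    · simp only [f, hAσ, hx, if_true]
      congr 1
      refine Quotient.sound ?_
      rw [← hπ x (hAT x hx)]
      exact cycleSetoid_apply π x
    · simp [f, hAσ, hx]
  have hfβ : ∀ x, f x = f (β x) := by
    intro x
    by_cases hx : x ∈ T
    · have h1 : x ∉ A := fun h => hAT x h hx
      have h2 : β x ∉ A := fun h => hAT _ h (hT x hx)
      simp [f, h1, h2]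
    · rw [hβ x hx]
  have hle : SameCycle.setoid σ ⊔ SameCycle.setoid β ≤ Setoid.ker f :=
    sup_le (cycleSetoid_le hfσ) (cycleSetoid_le hfβ)
  have h1 : (Set.range f).ncard ≤ (SameCycle.setoid σ ⊔ SameCycle.setoid β).numClasses := by
    rw [← Nat.card_coe_set_eq]
    exact Setoid.numClasses_le_of_surjective (Set.rangeFactorization f)
      Set.rangeFactorization_surjective fun x y hxy => Subtype.ext (hle hxy)
  have h2 : some '' (Quotient.mk (SameCycle.setoid π) '' T)ᶜ ⊆ Set.range f := by
    rintro _ ⟨q, hq, rfl⟩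
    induction q using Quotient.inductionOn with
    | _ x =>
    have hx : x ∈ A := fun y hxy hy => hq ⟨y, hy, Quotient.sound hxy.symm⟩
    exact ⟨x, by simp only [f, if_pos hx]⟩
  have h3 := Set.ncard_le_ncard h2 (Set.toFinite _)
  rw [Set.ncard_image_of_injective _ (Option.some_injective _)] at h3
  have h4 := Set.ncard_add_ncard_compl (Quotient.mk (SameCycle.setoid π) '' T)
  rw [Setoid.numClasses, ← h4]
  omega

/-- Euler's inequality for the submap of an oriented map that is spanned by a set of darts. -/
theorem ncard_le_of_submap [Finite D] [DecidableEq D] {σ α β : Perm D} {T : Set D}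
    (hα : ∀ x, α (α x) = x) (hne : ∀ x, α x ≠ x) (hT : ∀ x ∈ T, α x ∈ T)
    (hβT : ∀ x ∈ T, β x = α x) (hβ : ∀ x, x ∉ T → β x = x) :
    (T.ncard : ℤ) ≤ 2 * twiceGenus σ α + 2 * (Quotient.mk (SameCycle.setoid σ) '' T).ncard +
      2 * (Quotient.mk (SameCycle.setoid (σ * β)) '' T).ncard := by
  have hββ : ∀ x, β (β x) = x := by
    intro x
    by_cases hx : x ∈ T
    · rw [hβT x hx, hβT _ (hT x hx), hα]
    · rw [hβ x hx, hβ x hx]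
  have h1 := twiceGenus_mono σ hα hββ fun x => by
    by_cases hx : x ∈ T
    · exact Or.inl (hβT x hx)
    · exact Or.inr (hβ x hx)
  have hβT' : ∀ x ∈ T, β x ∈ T := fun x hx => by rw [hβT x hx]; exact hT x hx
  -- Vertices and faces that avoid `T` number at most the components, each time; the term with twice
  -- the components in `twiceGenus` absorbs both.
  have h2 := numClasses_le_ncard_add (π := σ) (fun _ _ => rfl) hβ hβT'
  have h3 := numClasses_le_ncard_add (σ := σ) (π := σ * β)
    (fun x hx => by rw [Perm.mul_apply, hβ x hx]) hβ hβT'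
  have h4 := two_mul_numClasses_involution hββ
  have h5 : {x | β x = x} = Tᶜ := by
    ext x
    by_cases hx : x ∈ T
    · simp [hx, hβT x hx, hne x]
    · simp [hx, hβ x hx]
  rw [h5] at h4
  have h6 := Set.ncard_add_ncard_compl T
  rw [twiceGenus] at h1
  omega

/-- Produces the next dart of `T` around a vertex. If it were `y` itself, the cycle of `y` would
meet `T` at most in `y`. -/
theorem Equiv.Perm.exists_first_return [Finite D] {σ : Perm D} {T : Set D} {y c : D}
    (hc : c ∈ T) (hcy : c ≠ y) (h : SameCycle σ y c) :
    ∃ k : ℕ, 0 < k ∧ (σ ^ k) y ∈ T ∧ (σ ^ k) y ≠ y ∧ ∀ j, 0 < j → j < k → (σ ^ j) y ∉ T := by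
  classical
  obtain ⟨m, hm0, -, hm⟩ := h.exists_pow_eq''
  have hex : ∃ k : ℕ, 0 < k ∧ (σ ^ k) y ∈ T := ⟨m, hm0, by rwa [hm]⟩
  let k := Nat.find hex
  obtain ⟨hk0, hk⟩ : 0 < k ∧ (σ ^ k) y ∈ T := Nat.find_spec hex
  have hmin : ∀ j, 0 < j → j < k → (σ ^ j) y ∉ T := fun j h0 hj hT => Nat.find_min hex hj ⟨h0, hT⟩
  refine ⟨k, hk0, hk, fun hky => hcy ?_, hmin⟩
  have hmod : (σ ^ (m % k)) y = c := by
    rw [← hm]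
    conv_rhs => rw [← Nat.mod_add_div m k, pow_add, Perm.mul_apply, pow_mul]
    rw [pow_apply_eq_self_of_apply_eq_self hky]
  rcases Nat.eq_zero_or_pos (m % k) with h0 | h0
  · rw [h0] at hmod; exact hmod.symm
  · exact absurd (hmod ▸ hc) (hmin _ h0 (Nat.mod_lt _ hk0))

/-- A face of the submap turns past the darts outside `T`, because `β` fixes them and `σ * β` acts
there as `σ`. -/
theorem Equiv.Perm.sameCycle_mul_of_pow {σ β : Perm D} {T : Set D} (hβ : ∀ x, x ∉ T → β x = x)
    {x : D} {k : ℕ} (hk : 0 < k) (h : ∀ j, 0 < j → j < k → (σ ^ j) (β x) ∉ T) :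
    SameCycle (σ * β) x ((σ ^ k) (β x)) := by
  induction k with
  | zero => omega
  | succ k ih =>
    rcases Nat.eq_zero_or_pos k with rfl | hk0
    · exact ⟨1, by simp⟩
    · refine (ih hk0 fun j h0 hj => h j h0 (by omega)).trans ⟨1, ?_⟩
      rw [zpow_one, Perm.mul_apply, hβ _ (h k hk0 (by omega)), pow_succ', Perm.mul_apply]

end Submap

/-! ### Lower bound: the faces of a drawing -/

theorem CellSurface.sup_cycleSetoid (S : CellSurface) :
    SameCycle.setoid S.rot ⊔ SameCycle.setoid S.rev = ⊤ := by
  refine top_le_iff.1 fun a b hab => ?_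
  clear hab
  obtain ⟨τ, hτ, rfl⟩ := S.connected a b
  set s := SameCycle.setoid S.rot ⊔ SameCycle.setoid S.rev with hs
  have h1 : ∀ x, s x (S.rot x) := fun x =>
    (le_sup_left : SameCycle.setoid S.rot ≤ s) (cycleSetoid_apply _ x)
  have h2 : ∀ x, s x (S.rev x) := fun x =>
    (le_sup_right : SameCycle.setoid S.rev ≤ s) (cycleSetoid_apply _ x)
  clear_value s
  suffices ∀ x, s x (τ x) from this a
  induction hτ using Subgroup.closure_induction with
  | mem x hx =>
    rcases hx with rfl | rfl
    · exact h1
    · exact h2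
  | one => exact s.refl
  | mul x y _ _ ihx ihy => exact fun a => s.trans (ihy a) (ihx _)
  | inv x _ ih =>
    intro a
    have := ih (x⁻¹ a)
    rw [← Perm.mul_apply, mul_inv_cancel, Perm.one_apply] at this
    exact s.symm this

theorem CellSurface.two_mul_numClasses_rev (S : CellSurface) :
    2 * (SameCycle.setoid S.rev).numClasses = Nat.card S.Dart := by
  have h2 := two_mul_numClasses_involution S.rev_rev
  have h3 : {x | S.rev x = x} = ∅ := by
    ext x; simp [S.rev_ne x]
  rwa [h3, Set.ncard_empty] at h2

theorem CellSurface.hasGenus_iff (S : CellSurface) {g : ℕ} :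
    S.HasGenus g ↔ twiceGenus S.rot S.rev = 2 * g := by
  have h2 := S.two_mul_numClasses_rev
  have h4 : S.HasGenus g ↔ ((SameCycle.setoid S.rot).numClasses : ℤ) -
      (SameCycle.setoid S.rev).numClasses + (SameCycle.setoid (S.rot * S.rev)).numClasses =
      2 - 2 * g := Iff.rfl
  rw [h4, twiceGenus, S.sup_cycleSetoid, Setoid.numClasses_top]
  omega

namespace SimpleGraph

variable {V : Type*}

/-- The number of darts of a graph without leaves is bounded by its genus, its number of vertices
and its number of short cycles. -/
theorem Drawing.card_dart_le [Finite V] {G : SimpleGraph V} {S : CellSurface} {g : ℕ}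
    (hS : S.HasGenus g) (φ : G.Drawing S) (hdeg : ∀ u v, G.Adj u v → ∃ w, w ≠ u ∧ G.Adj v w)
    (L k : ℕ) (hLk : L ≤ k) :
    L * Nat.card G.Dart ≤ L * (4 * g + 2 * Nat.card V) + 2 * Nat.card G.Dart +
      2 * L * (G.shortCyclePairs k).ncard := by
  classical
  have : Finite G.Dart := Finite.of_injective _ Dart.toProd_injective
  let T : Set S.Dart := Set.range φ.dart
  have hT : ∀ x ∈ T, S.rev x ∈ T := by
    rintro _ ⟨a, rfl⟩
    exact ⟨a.symm, φ.dart_symm a⟩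
  have hinv : Function.Involutive fun x => if x ∈ T then S.rev x else x := by
    intro x
    by_cases hx : x ∈ T
    · simp [hx, hT x hx, S.rev_rev]
    · simp [hx]
  -- The reversal restricted to `G`; the other darts remain as fixed points, invisible to the faces
  -- of the drawing.
  let β : Perm S.Dart := hinv.toPerm
  have hβT : ∀ x ∈ T, β x = S.rev x := fun x hx => if_pos hx
  have hβ : ∀ x, x ∉ T → β x = x := fun x hx => if_neg hx
  have hβdart : ∀ a, β (φ.dart a) = φ.dart a.symm := fun a => by
    rw [hβT _ ⟨a, rfl⟩, φ.dart_symm]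
  have hsrc : ∀ a b : G.Dart, SameCycle S.rot (φ.dart a) (φ.dart b) ↔ a.fst = b.fst := by
    intro a b
    rw [← φ.vert_injective.eq_iff, ← φ.source_dart, ← φ.source_dart]
    exact ⟨fun h => Quotient.sound h, fun h => Quotient.exact h⟩
  have hsrc' : ∀ (a : G.Dart) (z : S.Dart), SameCycle S.rot (φ.dart a) z → z ∈ T →
      ∃ b : G.Dart, φ.dart b = z ∧ b.fst = a.fst := by
    rintro a _ h ⟨b, rfl⟩
    exact ⟨b, rfl, ((hsrc a b).1 h).symm⟩
  have hother : ∀ a : G.Dart, ∃ c : G.Dart, c ≠ a ∧ c.fst = a.fst := by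
    intro a
    obtain ⟨w, hw, hvw⟩ := hdeg _ _ a.adj.symm
    exact ⟨⟨(a.fst, w), hvw⟩, fun e => hw (congrArg (fun d : G.Dart => d.snd) e), rfl⟩
  -- After `a` the face continues with the next dart of `G` around the end of `a`; degree at least 2
  -- keeps it from turning back.
  have hforward : ∀ a : G.Dart, ∃ b : G.Dart, SameCycle (S.rot * β) (φ.dart a) (φ.dart b) ∧
      b.fst = a.snd ∧ b ≠ a.symm := by
    intro a
    obtain ⟨c, hca, hc⟩ := hother a.symm
    obtain ⟨k, hk0, hkT, hkne, hk⟩ := exists_first_return (T := T) (y := φ.dart a.symm) ⟨c, rfl⟩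
      (fun e => hca (φ.dart_injective e)) ((hsrc _ _).2 hc.symm)
    obtain ⟨b, hb, hba⟩ := hsrc' a.symm _ ⟨k, rfl⟩ (by rwa [zpow_natCast])
    rw [zpow_natCast] at hb
    refine ⟨b, ?_, hba, fun e => hkne (by rw [← hb, e])⟩
    rw [hb, ← hβdart]
    refine sameCycle_mul_of_pow hβ hk0 fun j h0 hj => ?_
    rw [hβdart]
    exact hk j h0 hj
  -- The same for the dart preceding `a` in its face, by turning with the inverse rotation. Both
  -- directions are needed for the face graph to have no leaf.
  have hbackward : ∀ a : G.Dart, ∃ b : G.Dart, SameCycle (S.rot * β) (φ.dart a) (φ.dart b.symm) ∧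
      b.fst = a.fst ∧ b ≠ a := by
    intro a
    obtain ⟨c, hca, hc⟩ := hother a
    obtain ⟨k, hk0, hkT, hkne, hk⟩ := exists_first_return (σ := S.rot⁻¹) (T := T) (y := φ.dart a)
      ⟨c, rfl⟩ (fun e => hca (φ.dart_injective e)) (sameCycle_inv.2 ((hsrc _ _).2 hc.symm))
    obtain ⟨b, hb, hba⟩ := hsrc' a ((S.rot⁻¹ ^ k) (φ.dart a)) ⟨-k, by simp⟩ hkT
    refine ⟨b, ?_, hba, fun e => hkne (by rw [← hb, e])⟩
    have hpow : ∀ j, j ≤ k → (S.rot ^ j) (φ.dart b) = (S.rot⁻¹ ^ (k - j)) (φ.dart a) := by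
      intro j hj
      rw [hb, ← Perm.mul_apply]
      congr 1
      rw [inv_pow, inv_pow, ← zpow_natCast, ← zpow_natCast, ← zpow_natCast, ← zpow_neg, ← zpow_neg,
        ← zpow_add]
      congr 1
      push_cast [hj]
      ring
    have := sameCycle_mul_of_pow (σ := S.rot) (T := T) hβ (x := φ.dart b.symm) hk0 fun j h0 hj => by
      rw [hβdart, Dart.symm_symm, hpow j hj.le]
      exact hk _ (by omega) (by omega)
    rw [hβdart, Dart.symm_symm, hpow k le_rfl] at this
    simpa using this.symm
  have hface := mul_ncard_range_le (fun a => Quotient.mk (SameCycle.setoid (S.rot * β)) (φ.dart a))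
    {a : G.Dart | a.toProd ∈ G.shortCyclePairs k} L (by
      intro a ha
      let O : Set G.Dart := {b | SameCycle (S.rot * β) (φ.dart a) (φ.dart b)}
      have hO : (fun a => Quotient.mk (SameCycle.setoid (S.rot * β)) (φ.dart a)) ⁻¹'
          {Quotient.mk (SameCycle.setoid (S.rot * β)) (φ.dart a)} = O := by
        ext b
        exact ⟨fun h => (Quotient.exact h : SameCycle _ _ _).symm,
          fun h => Quotient.sound (SameCycle.symm h)⟩
      rw [hO] at ha
      -- The graph traced by the face of `a`. It has at most as many edges as the face has darts,
      -- hence fewer than `L`.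
      let H : SimpleGraph V := fromEdgeSet (Dart.edge '' O)
      have hH : ∀ u v, H.Adj u v ↔ ∃ b ∈ O, b.edge = s(u, v) := by
        intro u v
        simp only [H, fromEdgeSet_adj, Set.mem_image]
        refine ⟨fun h => h.1, fun h => ⟨h, ?_⟩⟩
        obtain ⟨b, -, hb⟩ := h
        have := b.edge_mem
        rw [hb] at this
        exact G.ne_of_adj this
      have hHb : ∀ b ∈ O, H.Adj b.fst b.snd := fun b hb => (hH _ _).2 ⟨b, hb, rfl⟩
      have hHG : H ≤ G := by
        intro u v huv
        obtain ⟨b, -, hb⟩ := (hH u v).1 huv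
        have := b.edge_mem
        rwa [hb] at this
      have hHdeg : ∀ u v, H.Adj u v → ∃ w, w ≠ u ∧ H.Adj v w := by
        intro u v huv
        obtain ⟨b, hbO, hb⟩ := (hH u v).1 huv
        rw [dart_edge_eq_mk'_iff'] at hb
        rcases hb with ⟨rfl, rfl⟩ | ⟨rfl, rfl⟩
        · obtain ⟨c, hc, hcb, hne⟩ := hforward b
          refine ⟨c.snd, fun e => hne ?_, ?_⟩
          · exact Dart.ext _ _ (Prod.ext hcb e)
          · have := hHb c (SameCycle.trans hbO hc)
            rwa [hcb] at this
        · obtain ⟨c, hc, hcb, hne⟩ := hbackward b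
          refine ⟨c.snd, fun e => hne ?_, ?_⟩
          · exact Dart.ext _ _ (Prod.ext hcb e)
          · have := (hHb c.symm (SameCycle.trans hbO hc)).symm
            change H.Adj c.fst c.snd at this
            rwa [hcb] at this
      obtain ⟨u, v, huv, hmem⟩ := exists_mem_shortCyclePairs hHG (hHb a (SameCycle.refl _ _)) hHdeg
        (k := k) (by
          refine le_trans ?_ hLk
          refine le_trans ?_ ha.le
          refine le_trans (Set.ncard_le_ncard ?_ (Set.toFinite _))
            (Set.ncard_image_le (f := Dart.edge) (s := O) (Set.toFinite _))
          intro e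
          induction e using Sym2.inductionOn with
          | _ u v =>
          intro h
          obtain ⟨b, hb, hbe⟩ := (hH u v).1 h
          exact ⟨b, hb, hbe⟩)
      obtain ⟨b, hbO, hb⟩ := (hH u v).1 huv
      refine ⟨b, ?_, Quotient.sound (SameCycle.symm hbO)⟩
      rw [dart_edge_eq_mk'_iff'] at hb
      rcases hb with ⟨rfl, rfl⟩ | ⟨rfl, rfl⟩
      · exact hmem
      · exact swap_mem_shortCyclePairs hmem)
  have hbad : {a : G.Dart | a.toProd ∈ G.shortCyclePairs k}.ncard ≤ (G.shortCyclePairs k).ncard :=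
    Set.ncard_le_ncard_of_injOn Dart.toProd (fun a ha => ha) Dart.toProd_injective.injOn
      (Set.toFinite _)
  have hmain := ncard_le_of_submap (σ := S.rot) S.rev_rev S.rev_ne hT hβT hβ
  have hTcard : T.ncard = Nat.card G.Dart := by
    rw [show T = φ.dart '' Set.univ from Set.image_univ.symm,
      Set.ncard_image_of_injective _ φ.dart_injective, Set.ncard_univ]
  have hV : (Quotient.mk (SameCycle.setoid S.rot) '' T).ncard ≤ Nat.card V := by
    rw [← Set.ncard_univ, ← Set.ncard_image_of_injective _ φ.vert_injective]
    refine Set.ncard_le_ncard ?_ (Set.toFinite _)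
    rintro _ ⟨_, ⟨a, rfl⟩, rfl⟩
    exact ⟨a.fst, trivial, (φ.source_dart a).symm⟩
  have hF : Quotient.mk (SameCycle.setoid (S.rot * β)) '' T =
      Set.range fun a => Quotient.mk (SameCycle.setoid (S.rot * β)) (φ.dart a) := by
    rw [← Set.range_comp]; rfl
  have hgen := S.hasGenus_iff.1 hS
  rw [hgen, hTcard, hF] at hmain
  set F := (Set.range fun a => Quotient.mk (SameCycle.setoid (S.rot * β)) (φ.dart a)).ncard
  have hmain' : Nat.card G.Dart ≤ 4 * g + 2 * Nat.card V + 2 * F := by omega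
  calc L * Nat.card G.Dart ≤ L * (4 * g + 2 * Nat.card V + 2 * F) := Nat.mul_le_mul_left _ hmain'
    _ = L * (4 * g + 2 * Nat.card V) + 2 * (L * F) := by ring
    _ ≤ L * (4 * g + 2 * Nat.card V) + 2 * (Nat.card G.Dart + L * (G.shortCyclePairs k).ncard) := by
      gcongr
      exact hface.trans (by gcongr)
    _ = _ := by ring

end SimpleGraph

/-! ### Upper bound: completing a rotation by a hub vertex -/

/-- Every equivalence relation on a finite set is the cycle relation of a permutation. -/
theorem Equiv.Perm.exists_sameCycle_iff {D X : Type*} [Finite D] (f : D → X) :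
    ∃ σ : Perm D, ∀ a b, SameCycle σ a b ↔ f a = f b := by
  classical
  have := Fintype.ofFinite D
  choose g hg _ using fun x : X => Finset.exists_cycleOn (Finset.univ.filter fun a : D => f a = x)
  have hgf : ∀ a, f (g (f a) a) = f a := fun a => by
    have := (hg (f a)).1.1 (show a ∈ _ by simp)
    simpa using this
  have hinj : Function.Injective fun a => g (f a) a := by
    intro a b hab
    have h1 := hgf a
    rw [show g (f a) a = g (f b) b from hab, hgf b] at h1
    change g (f a) a = g (f b) b at hab
    rw [h1] at hab
    exact (g (f a)).injective hab
  let σ : Perm D := Equiv.ofBijective _ (Finite.injective_iff_bijective.1 hinj)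
  have hσ : ∀ a, σ a = g (f a) a := fun a => rfl
  refine ⟨σ, fun a b => ⟨fun h => ?_, fun h => ?_⟩⟩
  · exact cycleSetoid_le (r := Setoid.ker f) (fun x => (hgf x).symm) h
  -- Along the orbit of `a` the value of `f` is constant, so `σ` acts as the single cycle chosen on
  -- that fibre.
  · have hpow : ∀ n : ℕ, (σ ^ n) a = (g (f a) ^ n) a ∧ f ((σ ^ n) a) = f a := by
      intro n
      induction n with
      | zero => simp
      | succ n ih =>
        rw [pow_succ', Perm.mul_apply, hσ, hgf, ih.2]
        exact ⟨by rw [ih.1, pow_succ', Perm.mul_apply], rfl⟩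
    obtain ⟨n, -, -, hn⟩ := ((hg (f a)).2 (x := a) (by simp) (y := b) (by simp [h])).exists_pow_eq''
    exact ⟨n, by rw [zpow_natCast, (hpow n).1, hn]⟩

/-- In a map all of whose vertices have degree two, no face meets both sides of an edge. -/
theorem not_sameCycle_mul_of_involutive {D : Type*} [Finite D] {σ α : Perm D} (hσ : ∀ a, σ (σ a) = a)
    (hσ' : ∀ a, σ a ≠ a) (hα : ∀ a, α (α a) = a) (hα' : ∀ a, α a ≠ a) (a : D) :
    ¬ SameCycle (σ * α) a (α a) := by
  intro h
  obtain ⟨k, -, -, hk⟩ := h.exists_pow_eq''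
  set φ := σ * α with hφ
  -- Since `σ` and `α` are involutions, `α` conjugates `φ` to its inverse, as in a dihedral group.
  have hφα : ∀ x, φ (α (φ x)) = α x := fun x => by simp [hφ, hα, hσ]
  clear_value φ
  have hconj : ∀ (m : ℕ) (x : D), (φ ^ m) (α ((φ ^ m) x)) = α x := by
    intro m
    induction m with
    | zero => simp
    | succ m ih =>
      intro x
      conv_lhs => rw [pow_succ, Perm.mul_apply, ← pow_succ, pow_succ', Perm.mul_apply, hφα]
      exact ih x
  have hadd : ∀ (m n : ℕ), (φ ^ m) ((φ ^ n) a) = (φ ^ (m + n)) a := fun m n => by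
    rw [pow_add, Perm.mul_apply]
  -- The midpoint of the walk from `a` to `α a` yields a fixed point of `α` for even `k` and of `σ`
  -- for odd `k`.
  rcases Nat.even_or_odd' k with ⟨m, rfl | rfl⟩
  · refine hα' ((φ ^ m) a) ((φ ^ m).injective ?_)
    rw [hconj, hadd, ← two_mul, hk]
  · refine hσ' (α ((φ ^ m) a)) ((φ ^ m).injective ?_)
    rw [hconj, show σ (α ((φ ^ m) a)) = (φ ^ (m + 1)) a by rw [pow_succ', Perm.mul_apply, hφ]; rfl,
      hadd, ← add_assoc, ← two_mul, hk]

section Hub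

variable {D C : Type*} [DecidableEq D] {comp : D → C} {r : C → D}

/-- Exchanges each root dart `r i` with its new dart; done before the rotation `σ`, this inserts the
new dart right after `r i`. -/
theorem hubSwap_involutive (hr : ∀ i, comp (r i) = i) : Function.Involutive
    (Sum.elim (fun a => if r (comp a) = a then Sum.inr (Sum.inl (comp a)) else Sum.inl a)
      (Sum.elim (fun i => Sum.inl (r i)) fun i => Sum.inr (Sum.inr i)) :
      D ⊕ C ⊕ C → D ⊕ C ⊕ C) := by
  rintro (a | i | i)
  · by_cases h : r (comp a) = a <;> simp [h]
  · simp [hr]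
  · rfl

/-- The rotation `σ` with a new dart inserted after every `r i`, and a new vertex with the cyclic
order `π` of its darts. -/
def hubRot (hr : ∀ i, comp (r i) = i) (σ : Perm D) (π : Perm C) : Perm (D ⊕ C ⊕ C) :=
  Equiv.sumCongr σ (Equiv.sumCongr (Equiv.refl C) π) * (hubSwap_involutive hr).toPerm

/-- The reversal that joins the new darts at the old vertices to the new vertex. -/
def hubRev (α : Perm D) : Perm (D ⊕ C ⊕ C) := Equiv.sumCongr α (Equiv.sumComm C C)

variable (hr : ∀ i, comp (r i) = i) (σ α : Perm D) (π : Perm C)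

theorem hubRot_root (i : C) : hubRot hr σ π (Sum.inl (r i)) = Sum.inr (Sum.inl i) := by
  simp [hubRot, hr]

theorem hubRot_inl {a : D} (h : r (comp a) ≠ a) : hubRot hr σ π (Sum.inl a) = Sum.inl (σ a) := by
  simp [hubRot, h]

theorem hubRot_inr_inl (i : C) : hubRot hr σ π (Sum.inr (Sum.inl i)) = Sum.inl (σ (r i)) := by
  simp [hubRot]

theorem hubRot_inr_inr (i : C) : hubRot hr σ π (Sum.inr (Sum.inr i)) = Sum.inr (Sum.inr (π i)) := by
  simp [hubRot]

theorem sameCycle_hubRot {a b : D} (h : SameCycle σ a b) :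
    SameCycle (hubRot hr σ π) (Sum.inl a) (Sum.inl b) := by
  refine cycleSetoid_le (r := Setoid.comap Sum.inl (SameCycle.setoid (hubRot hr σ π))) (fun a => ?_) h
  change SameCycle (hubRot hr σ π) (Sum.inl a) (Sum.inl (σ a))
  by_cases ha : r (comp a) = a
  · refine ⟨2, ?_⟩
    rw [← ha]
    change (hubRot hr σ π ^ (2 : ℕ)) _ = _
    rw [pow_two, Perm.mul_apply, hubRot_root, hubRot_inr_inl]
  · exact ⟨1, by rw [zpow_one, hubRot_inl hr σ π ha]⟩

theorem sameCycle_hubRot_inr {i j : C} (h : SameCycle π i j) :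
    SameCycle (hubRot hr σ π) (Sum.inr (Sum.inr i)) (Sum.inr (Sum.inr j)) := by
  refine cycleSetoid_le (r := Setoid.comap (fun i => Sum.inr (Sum.inr i))
    (SameCycle.setoid (hubRot hr σ π))) (fun i => ?_) h
  exact ⟨1, by rw [zpow_one, hubRot_inr_inr]⟩

theorem card_add_one_le_numClasses_hubRot [Finite D] [Finite C] [Nonempty C] {V : Type*} [Finite V]
    (v : D → V) (hv : Function.Surjective v) (hσ : ∀ a, v (σ a) = v a) :
    Nat.card V + 1 ≤ (SameCycle.setoid (hubRot hr σ π)).numClasses := by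
  rw [← Finite.card_option]
  refine card_le_numClasses (Sum.elim (fun a => some (v a))
    (Sum.elim (fun i => some (v (r i))) fun _ => none)) ?_ ?_
  · rintro (_ | x)
    · exact ⟨Sum.inr (Sum.inr (Classical.arbitrary C)), rfl⟩
    · obtain ⟨a, rfl⟩ := hv x
      exact ⟨Sum.inl a, rfl⟩
  · rintro (a | i | i)
    · by_cases ha : r (comp a) = a
      · rw [← ha, hubRot_root]; rfl
      · rw [hubRot_inl hr σ π ha]; simp [hσ]
    · rw [hubRot_inr_inl]; simp [hσ]
    · rw [hubRot_inr_inr]; rfl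

/-- The corner after `r i` lies on the face of `α (r i)`, which differs from that of `r i`. So the
spoke leaves the face of `r i` intact in each component, and the hub lies on a further face. -/
theorem card_add_one_le_numClasses_hubRot_mul [Finite D] [Finite C] [Nonempty C]
    (hσ : ∀ a, σ (σ a) = a) (hσ' : ∀ a, σ a ≠ a) (hα : ∀ a, α (α a) = a) (hα' : ∀ a, α a ≠ a)
    (hcσ : ∀ a, comp (σ a) = comp a) (hcα : ∀ a, comp (α a) = comp a) :
    Nat.card C + 1 ≤ (SameCycle.setoid (hubRot hr σ π * hubRev α)).numClasses := by
  classical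
  rw [← Finite.card_option]
  have hroot : ∀ i, ¬ SameCycle (σ * α) (r i) (α (r i)) := fun i =>
    not_sameCycle_mul_of_involutive hσ hσ' hα hα' _
  refine card_le_numClasses (Sum.elim (fun a => if SameCycle (σ * α) (r (comp a)) a then
    some (comp a) else none) fun _ => none) ?_ ?_
  · rintro (_ | i)
    · exact ⟨Sum.inr (Sum.inr (Classical.arbitrary C)), rfl⟩
    · refine ⟨Sum.inl (r i), ?_⟩
      simp [hr, SameCycle.refl]
  · rintro (a | i | i)
    · rw [Perm.mul_apply, show hubRev α (Sum.inl a) = (Sum.inl (α a) : D ⊕ C ⊕ C) from rfl]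
      by_cases ha : r (comp (α a)) = α a
      · rw [← ha, hubRot_root]
        have : ¬ SameCycle (σ * α) (r (comp a)) a := by
          have := hroot (comp a)
          rw [← hcα, ha, hα, ← ha, hcα] at this
          exact this
        simp only [Sum.elim_inr, Sum.elim_inl, if_neg this]
      · rw [hubRot_inl hr σ π ha]
        have : SameCycle (σ * α) (r (comp a)) (σ (α a)) ↔ SameCycle (σ * α) (r (comp a)) a :=
          sameCycle_apply_right (f := σ * α) (y := a)
        simp only [Sum.elim_inl, hcσ, hcα, this]
    · rw [Perm.mul_apply, show hubRev α (Sum.inr (Sum.inl i)) = (Sum.inr (Sum.inr i) : D ⊕ C ⊕ C)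
        from rfl, hubRot_inr_inr]
      rfl
    · rw [Perm.mul_apply, show hubRev α (Sum.inr (Sum.inr i)) = (Sum.inr (Sum.inl i) : D ⊕ C ⊕ C)
        from rfl, hubRot_inr_inl]
      have : ¬ SameCycle (σ * α) (r i) (σ (r i)) := by
        have h1 : SameCycle (σ * α) (r i) ((σ * α) (α (r i))) ↔ _ := sameCycle_apply_right
        rw [Perm.mul_apply, hα] at h1
        rw [h1]
        exact hroot i
      simp [hcσ, hr, this]

end Hub

namespace SimpleGraph

theorem card_dart_of_regular {V : Type*} [Finite V] {G : SimpleGraph V} {d : ℕ}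
    (hG : ∀ v, (G.neighborSet v).ncard = d) : Nat.card G.Dart = Nat.card V * d := by
  classical
  have := Fintype.ofFinite V
  have hsum := G.dart_card_eq_sum_degrees
  rw [← Nat.card_eq_fintype_card] at hsum
  rw [hsum, Finset.sum_congr rfl (g := fun _ => d)]
  · simp
  · intro v _
    rw [← hG v, ← G.card_neighborSet_eq_degree, ← Nat.card_eq_fintype_card, Nat.card_coe_set_eq]

/-- A graph without isolated vertices can be drawn on a surface, where the drawing is completed to
a cellular decomposition by a single vertex that is joined once to each component. -/
theorem exists_drawing {V : Type} [Finite V] [Nonempty V] (G : SimpleGraph V)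
    (hG : ∀ v, ∃ w, G.Adj v w) : ∃ S : CellSurface, ∃ g : ℕ, S.HasGenus g ∧ Nonempty (G.Drawing S) ∧
      4 * g + 2 * Nat.card V ≤ Nat.card G.Dart + 2 * Nat.card G.ConnectedComponent ∧
      ((∀ v, (G.neighborSet v).ncard = 2) → g = 0) := by
  classical
  have : Finite G.Dart := Finite.of_injective _ Dart.toProd_injective
  let C := G.ConnectedComponent
  let comp : G.Dart → C := fun a => G.connectedComponentMk a.fst
  have hex : ∀ i : C, ∃ a : G.Dart, comp a = i := by
    intro i
    induction i using ConnectedComponent.ind with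
    | _ v =>
    obtain ⟨w, hw⟩ := hG v
    exact ⟨⟨(v, w), hw⟩, rfl⟩
  choose r hr using hex
  obtain ⟨σ, hσ⟩ := exists_sameCycle_iff fun a : G.Dart => a.fst
  obtain ⟨π, hπ⟩ := exists_sameCycle_iff fun _ : C => ()
  have hσ1 : ∀ a, (σ a).fst = a.fst := fun a => ((hσ a (σ a)).1 ⟨1, by simp⟩).symm
  let α : Perm G.Dart := Function.Involutive.toPerm Dart.symm Dart.symm_symm
  have hα : ∀ a, α (α a) = a := Dart.symm_symm
  have hα' : ∀ a, α a ≠ a := Dart.symm_ne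
  have : Nonempty C := ⟨G.connectedComponentMk (Classical.arbitrary V)⟩
  let rot := hubRot hr σ π
  let rev : Perm (G.Dart ⊕ C ⊕ C) := hubRev α
  -- The orbit relation of the group generated by `rot` and `rev`; connectedness means that every
  -- dart is related to one hub dart.
  let s : Setoid (G.Dart ⊕ C ⊕ C) :=
    { r := fun x y => ∃ τ ∈ Subgroup.closure {rot, rev}, τ x = y
      iseqv :=
        { refl := fun x => ⟨1, one_mem _, rfl⟩
          symm := by
            rintro x _ ⟨τ, hτ, rfl⟩
            exact ⟨τ⁻¹, inv_mem hτ, by simp⟩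
          trans := by
            rintro x _ _ ⟨τ, hτ, rfl⟩ ⟨τ', hτ', rfl⟩
            exact ⟨τ' * τ, mul_mem hτ' hτ, rfl⟩ } }
  have hsrot : ∀ x, s x (rot x) := fun x => ⟨rot, Subgroup.subset_closure (by simp), rfl⟩
  have hsrev : ∀ x, s x (rev x) := fun x => ⟨rev, Subgroup.subset_closure (by simp), rfl⟩
  have hscyc : ∀ x y, SameCycle rot x y → s x y := fun x y h => cycleSetoid_le hsrot h
  have hsfst : ∀ a b : G.Dart, a.fst = b.fst → s (Sum.inl a) (Sum.inl b) := fun a b h =>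
    hscyc _ _ (sameCycle_hubRot hr σ π ((hσ a b).2 h))
  have hswalk : ∀ (u v : V) (p : G.Walk u v) (a b : G.Dart), a.fst = u → b.fst = v →
      s (Sum.inl a) (Sum.inl b) := by
    intro u v p
    induction p with
    | nil => exact fun a b ha hb => hsfst a b (ha.trans hb.symm)
    | @cons u w v h p ih =>
      intro a b ha hb
      refine s.trans (hsfst a ⟨(u, w), h⟩ ha) (s.trans (hsrev _) ?_)
      exact ih _ b rfl hb
  have hshub : ∀ i j : C, s (Sum.inr (Sum.inr i)) (Sum.inr (Sum.inr j)) := fun i j =>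
    hscyc _ _ (sameCycle_hubRot_inr hr σ π ((hπ i j).2 rfl))
  let i₀ : C := Classical.arbitrary C
  have hsinl : ∀ i : C, s (Sum.inr (Sum.inl i)) (Sum.inr (Sum.inr i₀)) := fun i =>
    s.trans (hsrev _) (hshub i i₀)
  have hs : ∀ x, s x (Sum.inr (Sum.inr i₀)) := by
    rintro (a | i | i)
    · obtain ⟨p⟩ := ConnectedComponent.exact (hr (comp a)).symm
      refine s.trans (hswalk _ _ p a (r (comp a)) rfl rfl) ?_
      refine s.trans (hsrot _) ?_
      rw [show rot (Sum.inl (r (comp a))) = _ from hubRot_root hr σ π (comp a)]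
      exact hsinl _
    · exact hsinl i
    · exact hshub i i₀
  let S : CellSurface :=
    { Dart := G.Dart ⊕ C ⊕ C
      fintypeDart := Fintype.ofFinite _
      decEqDart := Classical.decEq _
      nonemptyDart := ⟨Sum.inr (Sum.inr i₀)⟩
      rot := rot
      rev := rev
      rev_rev := by
        rintro (a | i | i)
        · exact congrArg Sum.inl (hα a)
        · rfl
        · rfl
      rev_ne := by
        rintro (a | i | i) h
        · exact hα' a (Sum.inl_injective h)
        · exact Sum.inr_ne_inl (Sum.inr_injective h)
        · exact Sum.inl_ne_inr (Sum.inr_injective h)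
      connected := fun a b => s.trans (hs a) (s.symm (hs b)) }
  obtain ⟨g, hg⟩ := exists_twiceGenus_eq S.rot S.rev_rev
  have hcardD : Nat.card S.Dart = Nat.card G.Dart + 2 * Nat.card G.ConnectedComponent := by
    change Nat.card (G.Dart ⊕ C ⊕ C) = _
    rw [Nat.card_sum, Nat.card_sum, two_mul]
  have hV : Nat.card V + 1 ≤ (SameCycle.setoid S.rot).numClasses :=
    card_add_one_le_numClasses_hubRot hr σ π (fun a : G.Dart => a.fst)
      (fun v => by obtain ⟨w, hw⟩ := hG v; exact ⟨⟨(v, w), hw⟩, rfl⟩) hσ1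
  have hE := S.two_mul_numClasses_rev
  have hF : 1 ≤ (SameCycle.setoid (S.rot * S.rev)).numClasses := by
    have := card_le_numClasses (π := S.rot * S.rev) (fun _ => ()) (fun _ => ⟨S.nonemptyDart.some, rfl⟩)
      fun _ => rfl
    simpa using this
  have hgen := hg
  rw [twiceGenus, S.sup_cycleSetoid, Setoid.numClasses_top] at hg
  refine ⟨S, g, S.hasGenus_iff.2 hgen, ?_, by omega, fun h2 => ?_⟩
  · choose nb hnb using hG
    -- Distinct vertices stay distinct because the old vertex at which a dart is attached is
    -- invariant under `rot`.
    have hinv : ∀ x y, SameCycle rot x y → ∀ (f : G.Dart ⊕ C ⊕ C → V ⊕ Unit),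
        (∀ x, f (rot x) = f x) → f x = f y := fun x y h f hf =>
      cycleSetoid_le (r := Setoid.ker f) (fun x => (hf x).symm) h
    refine ⟨{ vert := fun v => S.source (Sum.inl ⟨(v, nb v), hnb v⟩)
              vert_injective := ?_
              dart := Sum.inl
              dart_injective := Sum.inl_injective
              dart_symm := fun a => rfl
              source_dart := ?_ }⟩
    · intro u v huv
      have := hinv _ _ (Quotient.exact huv) (Sum.elim (fun a => Sum.inl a.fst)
        (Sum.elim (fun i => Sum.inl (r i).fst) fun _ => Sum.inr ())) (by
          rintro (a | i | i)
          · by_cases ha : r (comp a) = a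
            · rw [← ha, show rot (Sum.inl (r (comp a))) = _ from hubRot_root hr σ π (comp a)]; rfl
            · rw [show rot (Sum.inl a) = _ from hubRot_inl hr σ π ha]; simp [hσ1]
          · rw [show rot (Sum.inr (Sum.inl i)) = _ from hubRot_inr_inl hr σ π i]; simp [hσ1]
          · rw [show rot (Sum.inr (Sum.inr i)) = _ from hubRot_inr_inr hr σ π i]; rfl)
      exact Sum.inl_injective this
    · intro a
      exact Quotient.sound (sameCycle_hubRot hr σ π ((hσ _ _).2 rfl))
  -- At a vertex of degree 2 only one other dart is left, which forces `σ` to be an involution.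
  · have hfib : ∀ a b c : G.Dart, b.fst = a.fst → c.fst = a.fst → b ≠ a → c ≠ a → b = c := by
      intro a b c hb hc hba hca
      obtain ⟨x, y, -, hxy⟩ := Set.ncard_eq_two.1 (h2 a.fst)
      have key : ∀ d : G.Dart, d.fst = a.fst → d.snd = x ∨ d.snd = y := by
        intro d hd
        have : d.snd ∈ G.neighborSet a.fst := by rw [← hd]; exact d.adj
        rw [hxy] at this
        exact this
      have hne : ∀ d e : G.Dart, d.fst = a.fst → e.fst = a.fst → d ≠ e → d.snd ≠ e.snd :=
        fun d e hd he hde h => hde (Dart.ext _ _ (Prod.ext (hd.trans he.symm) h))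
      by_contra hbc
      have h1 := hne b a hb rfl hba
      have h2 := hne c a hc rfl hca
      have h3 := hne b c hb hc hbc
      rcases key a rfl with ha | ha <;> rcases key b hb with hb | hb <;>
        rcases key c hc with hc | hc <;> simp_all
    have hσ' : ∀ a, σ a ≠ a := by
      intro a ha
      obtain ⟨w, hw, hwa⟩ := Set.exists_ne_of_one_lt_ncard
        (show 1 < (G.neighborSet a.fst).ncard by rw [h2]; norm_num) a.snd
      obtain ⟨i, hi⟩ := (hσ a ⟨(a.fst, w), hw⟩).2 rfl
      rw [zpow_apply_eq_self_of_apply_eq_self ha] at hi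
      exact hwa (congrArg (fun d : G.Dart => d.snd) hi).symm
    have hσσ : ∀ a, σ (σ a) = a := by
      intro a
      by_contra h
      refine hσ' (σ a) (hfib a _ _ ?_ (hσ1 a) h (hσ' a))
      rw [hσ1, hσ1]
    have := card_add_one_le_numClasses_hubRot_mul hr σ α π hσσ hσ' hα hα'
      (fun a => by simp only [comp, hσ1])
      (fun a => ConnectedComponent.sound a.adj.symm.reachable)
    have hF' : Nat.card G.ConnectedComponent + 1 ≤ (SameCycle.setoid (S.rot * S.rev)).numClasses := this
    have hdart := card_dart_of_regular h2
    omega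

end SimpleGraph

/-! ### Few components -/

namespace SimpleGraph

/-- A component with fewer than `L` vertices has at most `L * L ≤ k` edges and no leaf, so it
contains an edge on a short cycle. -/
theorem mul_card_connectedComponent_le {V : Type*} [Finite V] (G : SimpleGraph V)
    (hG : ∀ v, ∃ w, G.Adj v w) (hdeg : ∀ u v, G.Adj u v → ∃ w, w ≠ u ∧ G.Adj v w)
    (L k : ℕ) (hLk : L * L ≤ k) :
    L * Nat.card G.ConnectedComponent ≤ Nat.card V + L * (G.shortCyclePairs k).ncard := by
  have h := mul_ncard_range_le G.connectedComponentMk (Prod.fst '' G.shortCyclePairs k) L (by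
    intro v hv
    set U := G.connectedComponentMk ⁻¹' {G.connectedComponentMk v}
    have hU : ∀ u w, G.Adj u w → u ∈ U → w ∈ U := fun u w huw hu =>
      (ConnectedComponent.sound huw.symm.reachable).trans hu
    let H : SimpleGraph V :=
      { Adj := fun u w => G.Adj u w ∧ u ∈ U
        symm := ⟨fun u w h => ⟨h.1.symm, hU u w h.1 h.2⟩⟩
        loopless := ⟨fun u h => G.loopless.irrefl u h.1⟩ }
    obtain ⟨w, hw⟩ := hG v
    obtain ⟨x, y, hxy, hmem⟩ := exists_mem_shortCyclePairs (G := G) (H := H) (fun _ _ h => h.1)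
      (a := v) (b := w) ⟨hw, rfl⟩ (fun u w huw => by
        obtain ⟨z, hz, hwz⟩ := hdeg u w huw.1
        exact ⟨z, hz, hwz, hU u w huw.1 huw.2⟩) (k := k) (by
          refine le_trans ?_ hLk
          calc H.edgeSet.ncard ≤ ((fun p : V × V => s(p.1, p.2)) '' (U ×ˢ U)).ncard := by
                refine Set.ncard_le_ncard ?_ (Set.toFinite _)
                intro e
                induction e using Sym2.inductionOn with
                | _ u w => exact fun h => ⟨(u, w), ⟨h.2, hU u w h.1 h.2⟩, rfl⟩
            _ ≤ (U ×ˢ U).ncard := Set.ncard_image_le (Set.toFinite _)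
            _ = U.ncard * U.ncard := Set.ncard_prod
            _ ≤ L * L := Nat.mul_le_mul hv.le hv.le)
    exact ⟨x, ⟨(x, y), hmem, rfl⟩, hxy.2⟩)
  have hr : Set.range G.connectedComponentMk = Set.univ :=
    Set.range_eq_univ.2 Quot.mk_surjective
  rw [hr, Set.ncard_univ] at h
  exact h.trans (by gcongr; exact Set.ncard_image_le (Set.toFinite _))

/-! ### Switchings and the mean number of short cycles -/

section Switching

variable {V : Type*}

/-- The graph in which the edges `ab`, `xy` are exchanged with the non-edges `ax`, `by`. -/
def switch (G : SimpleGraph V) (a b x y : V) : SimpleGraph V :=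
  symmDiff G (fromEdgeSet {s(a, b), s(x, y), s(a, x), s(b, y)})

theorem switch_switch (G : SimpleGraph V) (a b x y : V) :
    (G.switch a b x y).switch a b x y = G := by
  rw [switch, switch, symmDiff_assoc, symmDiff_self, symmDiff_bot]

theorem switch_adj (G : SimpleGraph V) (a b x y u v : V) : (G.switch a b x y).Adj u v ↔
    G.Adj u v ∧ ¬ ((s(u, v) = s(a, b) ∨ s(u, v) = s(x, y) ∨ s(u, v) = s(a, x) ∨ s(u, v) = s(b, y)) ∧
        u ≠ v) ∨
      ((s(u, v) = s(a, b) ∨ s(u, v) = s(x, y) ∨ s(u, v) = s(a, x) ∨ s(u, v) = s(b, y)) ∧ u ≠ v) ∧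
        ¬ G.Adj u v := by
  simp only [switch, symmDiff, sup_adj, sdiff_adj, fromEdgeSet_adj, Set.mem_insert_iff,
    Set.mem_singleton_iff]

/-- Adding `p` to the new neighbourhood and `q` to the old one gives the same set. -/
theorem ncard_neighborSet_of_exchange [Finite V] {G G' : SimpleGraph V} {u p q : V}
    (hp : G.Adj u p) (hq : ¬ G.Adj u q) (hp' : ¬ G'.Adj u p) (hq' : G'.Adj u q)
    (h : ∀ v, v ≠ p → v ≠ q → (G'.Adj u v ↔ G.Adj u v)) :
    (G'.neighborSet u).ncard = (G.neighborSet u).ncard := by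
  have e : insert p (G'.neighborSet u) = insert q (G.neighborSet u) := by
    ext v
    simp only [Set.mem_insert_iff, mem_neighborSet]
    by_cases h1 : v = p
    · simp [h1, hp]
    by_cases h2 : v = q
    · simp [h2, hq']
    simp [h1, h2, h v h1 h2]
  have e' := congrArg Set.ncard e
  rw [Set.ncard_insert_of_notMem (s := G'.neighborSet u) hp',
    Set.ncard_insert_of_notMem (s := G.neighborSet u) hq] at e'
  omega

theorem ncard_neighborSet_switch [Finite V] {G : SimpleGraph V} {a b x y : V} (hab : G.Adj a b)
    (hxy : G.Adj x y) (hax : ¬ G.Adj a x) (hby : ¬ G.Adj b y) (hxa : x ≠ a) (hxb : x ≠ b)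
    (hya : y ≠ a) (hyb : y ≠ b) (u : V) :
    ((G.switch a b x y).neighborSet u).ncard = (G.neighborSet u).ncard := by
  have hab' := hab.ne
  have hxy' := hxy.ne
  have hba := hab.symm
  have hyx := hxy.symm
  have hxa' : ¬ G.Adj x a := fun h => hax h.symm
  have hyb' : ¬ G.Adj y b := fun h => hby h.symm
  by_cases h1 : u = a
  · subst h1
    refine ncard_neighborSet_of_exchange (p := b) (q := x) hab hax ?_ ?_ fun v hv hv' => ?_ <;>
      simp only [switch_adj, Sym2.eq_iff] <;> grind
  by_cases h2 : u = b
  · subst h2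
    refine ncard_neighborSet_of_exchange (p := a) (q := y) hba hby ?_ ?_ fun v hv hv' => ?_ <;>
      simp only [switch_adj, Sym2.eq_iff] <;> grind
  by_cases h3 : u = x
  · subst h3
    refine ncard_neighborSet_of_exchange (p := y) (q := a) hxy hxa' ?_ ?_ fun v hv hv' => ?_ <;>
      simp only [switch_adj, Sym2.eq_iff] <;> grind
  by_cases h4 : u = y
  · subst h4
    refine ncard_neighborSet_of_exchange (p := x) (q := b) hyx hyb' ?_ ?_ fun v hv hv' => ?_ <;>
      simp only [switch_adj, Sym2.eq_iff] <;> grind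
  congr 1
  ext v
  simp only [mem_neighborSet, switch_adj, Sym2.eq_iff]
  grind

open scoped Classical in
theorem card_filter_adj [Fintype V] (G : SimpleGraph V) (v : V) :
    (Finset.univ.filter (G.Adj v)).card = (G.neighborSet v).ncard := by
  rw [← Set.ncard_coe_finset]
  congr 1
  ext
  simp

open scoped Classical in
theorem card_ball_le [Fintype V] {G : SimpleGraph V} {d : ℕ}
    (hG : ∀ v, (G.neighborSet v).ncard = d) (k : ℕ) (a : V) :
    (Finset.univ.filter fun b => ∃ w : G.Walk a b, w.length ≤ k).card ≤ (d + 1) ^ k := by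
  induction k generalizing a with
  | zero =>
    rw [pow_zero]
    refine Finset.card_le_one.2 fun b hb c hc => ?_
    simp only [Finset.mem_filter, Finset.mem_univ, true_and, nonpos_iff_eq_zero] at hb hc
    obtain ⟨w, hw⟩ := hb
    obtain ⟨w', hw'⟩ := hc
    exact (Walk.eq_of_length_eq_zero hw).symm.trans (Walk.eq_of_length_eq_zero hw')
  | succ k ih =>
    have hsub : (Finset.univ.filter fun b => ∃ w : G.Walk a b, w.length ≤ k + 1) ⊆
        (Finset.univ.filter fun b => ∃ w : G.Walk a b, w.length ≤ k) ∪
        (Finset.univ.filter (G.Adj a)).biUnion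
          fun c => Finset.univ.filter fun b => ∃ w : G.Walk c b, w.length ≤ k := by
      intro b hb
      simp only [Finset.mem_filter, Finset.mem_univ, true_and, Finset.mem_union,
        Finset.mem_biUnion] at hb ⊢
      obtain ⟨w, hw⟩ := hb
      cases w with
      | nil => exact Or.inl ⟨Walk.nil, by simp⟩
      | cons h p => exact Or.inr ⟨_, h, p, by simpa using hw⟩
    refine (Finset.card_le_card hsub).trans ((Finset.card_union_le _ _).trans ?_)
    have h2 := Finset.card_biUnion_le_card_mul (Finset.univ.filter (G.Adj a))
      (fun c => Finset.univ.filter fun b => ∃ w : G.Walk c b, w.length ≤ k) ((d + 1) ^ k)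
      (fun c _ => ih c)
    rw [card_filter_adj, hG] at h2
    calc _ ≤ (d + 1) ^ k + d * (d + 1) ^ k := Nat.add_le_add (ih a) h2
      _ = (d + 1) ^ (k + 1) := by ring

/-- The oriented edges `xy` that can be switched with `ab` so that a short walk from `a` to `b`
survives. -/
def switchable (G : SimpleGraph V) (k : ℕ) (a b : V) : Set (V × V) :=
  {q | G.Adj q.1 q.2 ∧ q.1 ∉ insert a (insert b (G.neighborSet a)) ∧
    q.2 ∉ insert a (insert b (G.neighborSet b)) ∧
    ∃ w : (G.deleteEdges {s(a, b)}).Walk a b, w.length ≤ k ∧ s(q.1, q.2) ∉ w.edges}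

open scoped Classical in
theorem card_filter_adj_fst_le [Fintype V] {G : SimpleGraph V} {d : ℕ}
    (hG : ∀ v, (G.neighborSet v).ncard = d) (S : Finset V) :
    (Finset.univ.filter fun q : V × V => G.Adj q.1 q.2 ∧ q.1 ∈ S).card ≤ S.card * d := by
  refine le_trans (Finset.card_le_card ?_) (Finset.card_biUnion_le_card_mul S
    (fun x => (Finset.univ.filter (G.Adj x)).image fun y => (x, y)) d fun x _ => ?_)
  · rintro ⟨x, y⟩ h
    simp only [Finset.mem_filter, Finset.mem_univ, true_and] at h
    simp [h]
  · refine Finset.card_image_le.trans ?_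
    rw [card_filter_adj, hG]

/-- Of the `|V| * d` oriented edges, at most `(d + 2) * d` are lost for each of the two end
conditions, and `2 * k` for the edges of one fixed walk in both orientations. -/
theorem le_ncard_switchable [Finite V] {G : SimpleGraph V} {d : ℕ}
    (hG : ∀ v, (G.neighborSet v).ncard = d) {k : ℕ} {a b : V}
    (hab : (a, b) ∈ G.shortCyclePairs k) :
    Nat.card V * d ≤ (G.switchable k a b).ncard + (2 * ((d + 2) * d) + 2 * k) := by
  classical
  have := Fintype.ofFinite V
  obtain ⟨-, w, hw⟩ := hab
  let N : V → Finset V := fun c => insert a (insert b (Finset.univ.filter (G.Adj c)))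
  have hN : ∀ c, (N c).card ≤ d + 2 := fun c => by
    refine (Finset.card_insert_le _ _).trans (Nat.succ_le_succ ?_)
    refine (Finset.card_insert_le _ _).trans (Nat.succ_le_succ ?_)
    rw [card_filter_adj, hG]
  let A : Finset (V × V) := Finset.univ.filter fun q => G.Adj q.1 q.2
  let A₁ : Finset (V × V) := Finset.univ.filter fun q => G.Adj q.1 q.2 ∧ q.1 ∈ N a
  let A₂ : Finset (V × V) := Finset.univ.filter fun q => G.Adj q.1 q.2 ∧ q.2 ∈ N b
  let W : Finset (V × V) := (w.darts.map fun c => c.toProd).toFinset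
  have hW : W.card ≤ k := by
    refine (List.toFinset_card_le _).trans ?_
    rw [List.length_map, Walk.length_darts]
    exact hw
  have hA : A.card = Nat.card V * d := by
    rw [Finset.card_filter, Fintype.sum_prod_type, Nat.card_eq_fintype_card]
    simp only [← Finset.card_filter]
    simp_rw [card_filter_adj, hG]
    simp
  have hA₁ : A₁.card ≤ (d + 2) * d :=
    (card_filter_adj_fst_le hG (N a)).trans (Nat.mul_le_mul_right _ (hN a))
  have hA₂ : A₂.card ≤ (d + 2) * d := by
    refine le_trans (Finset.card_le_card_of_injOn Prod.swap ?_ Prod.swap_injective.injOn)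
      ((card_filter_adj_fst_le hG (N b)).trans (Nat.mul_le_mul_right _ (hN b)))
    intro q hq
    simp only [A₂, Finset.coe_filter, Finset.mem_univ, true_and, Set.mem_ofPred_eq] at hq ⊢
    exact ⟨hq.1.symm, hq.2⟩
  have hsub : A ⊆ (G.switchable k a b).toFinset ∪ (A₁ ∪ A₂ ∪ (W ∪ W.image Prod.swap)) := by
    rintro ⟨x, y⟩ hq
    simp only [A, Finset.mem_filter, Finset.mem_univ, true_and] at hq
    by_cases h1 : x ∈ N a
    · simp [A₁, hq, h1]
    by_cases h2 : y ∈ N b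
    · simp [A₂, hq, h2]
    by_cases h3 : s(x, y) ∈ w.edges
    · obtain ⟨c, hc, hce⟩ := List.mem_map.1 h3
      rw [dart_edge_eq_mk'_iff] at hce
      have hcW : c.toProd ∈ W := by
        simp only [W, List.mem_toFinset, List.mem_map]
        exact ⟨c, hc, rfl⟩
      rcases hce with hce | hce
      · rw [hce] at hcW
        simp [hcW]
      · have hcW' : (x, y) ∈ W.image Prod.swap :=
          Finset.mem_image.2 ⟨c.toProd, hcW, by rw [hce]; rfl⟩
        exact Finset.mem_union_right _ (Finset.mem_union_right _ (Finset.mem_union_right _ hcW'))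
    · refine Finset.mem_union_left _ (Set.mem_toFinset.2 ⟨hq, ?_, ?_, w, hw, h3⟩)
      · simpa [N] using h1
      · simpa [N] using h2
  have hfin := Finset.card_le_card hsub
  rw [hA] at hfin
  have u1 := Finset.card_union_le (G.switchable k a b).toFinset
    (A₁ ∪ A₂ ∪ (W ∪ W.image Prod.swap))
  have u2 := Finset.card_union_le (A₁ ∪ A₂) (W ∪ W.image Prod.swap)
  have u3 := Finset.card_union_le A₁ A₂
  have u4 := Finset.card_union_le W (W.image Prod.swap)
  have u5 : (W.image Prod.swap).card ≤ W.card := Finset.card_image_le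
  rw [Set.ncard_eq_toFinset_card']
  omega

open scoped Classical in
/-- On average over the `d`-regular graphs, few edges lie on short cycles. -/
theorem mul_sum_ncard_shortCyclePairs_le [Fintype V] {d k m : ℕ}
    (hm : m + (2 * ((d + 2) * d) + 2 * k) ≤ Nat.card V * d) (R : Finset (SimpleGraph V))
    (hR : ∀ G, G ∈ R ↔ ∀ v, (G.neighborSet v).ncard = d) :
    m * ∑ G ∈ R, (G.shortCyclePairs k).ncard ≤ R.card * (Nat.card V * (d + 1) ^ k * (d * d)) := by
  let X : Finset (Σ _ : SimpleGraph V, Σ _ : V × V, V × V) := R.sigma fun G =>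
    (G.shortCyclePairs k).toFinset.sigma fun p => (G.switchable k p.1 p.2).toFinset
  -- After switching, `a` and `b` are joined by a short walk, `x` is a neighbour of `a` and `y` of
  -- `b`: few choices, since balls have bounded size.
  let Y : Finset (Σ _ : SimpleGraph V, Σ _ : V × V, V × V) := R.sigma fun G =>
    (Finset.univ.filter fun p : V × V => ∃ w : G.Walk p.1 p.2, w.length ≤ k).sigma fun p =>
      Finset.univ.filter (G.Adj p.1) ×ˢ Finset.univ.filter (G.Adj p.2)
  have hXY : X.card ≤ Y.card := by
    refine Finset.card_le_card_of_injOn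
      (fun t => ⟨t.1.switch t.2.1.1 t.2.1.2 t.2.2.1 t.2.2.2, t.2⟩) ?_ ?_
    · rintro ⟨G, ⟨a, b⟩, ⟨x, y⟩⟩ ht
      simp only [X, Finset.mem_coe, Finset.mem_sigma, Set.mem_toFinset] at ht
      obtain ⟨hG, ⟨hab, -⟩, hxy, hx, hy, w, hw, hwe⟩ := ht
      simp only [Set.mem_insert_iff, mem_neighborSet, not_or] at hx hy hab hxy hwe
      obtain ⟨hxa, hxb, hax⟩ := hx
      obtain ⟨hya, hyb, hby⟩ := hy
      simp only [Y, Finset.mem_coe, Finset.mem_sigma, Finset.mem_product, Finset.mem_filter,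
        Finset.mem_univ, true_and]
      have hab' := hab.ne
      have hxy' := hxy.ne
      refine ⟨(hR _).2 fun v => ?_, ?_, ?_, ?_⟩
      · rw [ncard_neighborSet_switch hab hxy hax hby hxa hxb hya hyb]
        exact (hR G).1 hG v
      -- The walk survives: it avoids the deleted edges `ab` and `xy`, while `ax` and `by` were not
      -- edges of `G`.
      · refine ⟨w.transfer _ fun e he => ?_, by rwa [Walk.length_transfer]⟩
        have he' := w.edges_subset_edgeSet he
        induction e using Sym2.inductionOn with
        | _ u v =>
        rw [mem_edgeSet, deleteEdges_adj, Set.mem_singleton_iff] at he'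
        rw [mem_edgeSet, switch_adj]
        refine Or.inl ⟨he'.1, ?_⟩
        rintro ⟨h | h | h | h, -⟩
        · exact he'.2 h
        · exact hwe (h ▸ he)
        · refine hax ?_
          rw [← mem_edgeSet, ← h]; exact he'.1
        · refine hby ?_
          rw [← mem_edgeSet, ← h]; exact he'.1
      · rw [switch_adj]
        exact Or.inr ⟨⟨Or.inr (Or.inr (Or.inl rfl)), Ne.symm hxa⟩, hax⟩
      · rw [switch_adj]
        exact Or.inr ⟨⟨Or.inr (Or.inr (Or.inr rfl)), Ne.symm hyb⟩, hby⟩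
    -- The recorded vertices allow the switching to be undone.
    · rintro ⟨G, t⟩ - ⟨G', t'⟩ - h
      simp only [Sigma.mk.injEq, heq_eq_eq] at h
      obtain ⟨h, rfl⟩ := h
      have := congrArg (fun K : SimpleGraph V => K.switch t.1.1 t.1.2 t.2.1 t.2.2) h
      simp only [switch_switch] at this
      rw [this]
  have hX : m * ∑ G ∈ R, (G.shortCyclePairs k).ncard ≤ X.card := by
    rw [Finset.card_sigma, Finset.mul_sum]
    refine Finset.sum_le_sum fun G hG => ?_
    rw [Finset.card_sigma, mul_comm, Set.ncard_eq_toFinset_card', ← smul_eq_mul]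
    refine Finset.card_nsmul_le_sum _ _ _ fun p hp => ?_
    have := le_ncard_switchable ((hR G).1 hG) (Set.mem_toFinset.1 hp)
    rw [← Set.ncard_eq_toFinset_card']
    omega
  have hY : Y.card ≤ R.card * (Nat.card V * (d + 1) ^ k * (d * d)) := by
    rw [Finset.card_sigma, ← smul_eq_mul R.card]
    refine Finset.sum_le_card_nsmul _ _ _ fun G hG => ?_
    have hG := (hR G).1 hG
    rw [Finset.card_sigma]
    simp only [Finset.card_product, card_filter_adj, hG, Finset.sum_const, smul_eq_mul]
    refine Nat.mul_le_mul_right _ ?_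
    rw [Finset.card_filter, Fintype.sum_prod_type, Nat.card_eq_fintype_card]
    simp only [← Finset.card_filter]
    rw [← smul_eq_mul, Fintype.card]
    exact Finset.sum_le_card_nsmul _ _ _ fun a _ => card_ball_le hG k a
  exact hX.trans (hXY.trans hY)

end Switching

end SimpleGraph

/-! ### Genus bounds for regular graphs -/

namespace SimpleGraph

theorem exists_adj_of_regular {V : Type*} {G : SimpleGraph V} {d : ℕ} (hd : 2 ≤ d)
    (hG : ∀ v, (G.neighborSet v).ncard = d) (u v : V) : ∃ w, w ≠ u ∧ G.Adj v w := by
  obtain ⟨w, hw, hwu⟩ := Set.exists_ne_of_one_lt_ncard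
    (show 1 < (G.neighborSet v).ncard by rw [hG]; omega) u
  exact ⟨w, hwu, hw⟩

theorem exists_drawing_of_regular {V : Type} [Finite V] [Nonempty V] {G : SimpleGraph V} {d : ℕ}
    (hd : 2 ≤ d) (hG : ∀ v, (G.neighborSet v).ncard = d) :
    ∃ S : CellSurface, ∃ g : ℕ, S.HasGenus g ∧ Nonempty (G.Drawing S) ∧
      4 * g + 2 * Nat.card V ≤ Nat.card V * d + 2 * Nat.card G.ConnectedComponent ∧
      (d = 2 → g = 0) := by
  obtain ⟨S, g, h1, h2, h3, h4⟩ := G.exists_drawing fun v => by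
    obtain ⟨w, -, hw⟩ := exists_adj_of_regular hd hG v v
    exact ⟨w, hw⟩
  rw [card_dart_of_regular hG] at h3
  exact ⟨S, g, h1, h2, h3, fun h => h4 fun v => by rw [hG, h]⟩

theorem genus_eq_zero_of_two_regular {V : Type} [Finite V] [Nonempty V] {G : SimpleGraph V}
    (hG : ∀ v, (G.neighborSet v).ncard = 2) : G.genus = 0 := by
  obtain ⟨S, g, h1, h2, -, h4⟩ := exists_drawing_of_regular le_rfl hG
  rw [h4 rfl] at h1
  exact Nat.le_zero.1 (Nat.sInf_le ⟨S, h1, h2⟩)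

theorem genus_le_of_regular {V : Type} [Finite V] [Nonempty V] {G : SimpleGraph V} {d : ℕ}
    (hd : 2 ≤ d) (hG : ∀ v, (G.neighborSet v).ncard = d) :
    4 * G.genus + 2 * Nat.card V ≤ Nat.card V * d + 2 * Nat.card G.ConnectedComponent := by
  obtain ⟨S, g, h1, h2, h3, -⟩ := exists_drawing_of_regular hd hG
  have : G.genus ≤ g := Nat.sInf_le ⟨S, h1, h2⟩
  omega

theorem le_genus_of_regular {V : Type} [Finite V] [Nonempty V] {G : SimpleGraph V} {d : ℕ}
    (hd : 2 ≤ d) (hG : ∀ v, (G.neighborSet v).ncard = d) (L k : ℕ) (hLk : L ≤ k) :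
    L * (Nat.card V * d) ≤ L * (4 * G.genus + 2 * Nat.card V) + 2 * (Nat.card V * d) +
      2 * L * (G.shortCyclePairs k).ncard := by
  obtain ⟨S, g, h1, h2, -, -⟩ := exists_drawing_of_regular hd hG
  -- Without a drawing the infimum would be the default value 0; nonemptiness makes it attained.
  have hne : {g : ℕ | ∃ S : CellSurface, S.HasGenus g ∧ Nonempty (G.Drawing S)}.Nonempty :=
    ⟨g, S, h1, h2⟩
  obtain ⟨S', hS', ⟨φ⟩⟩ := Nat.sInf_mem hne
  rw [← card_dart_of_regular hG]
  exact φ.card_dart_le hS' (fun u v _ => exists_adj_of_regular hd hG u v) L k hLk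

/-- A regular graph with few edges on short cycles has almost the largest genus that its number
of edges allows. -/
theorem genus_bounds_of_regular {V : Type} [Finite V] [Nonempty V] {G : SimpleGraph V} {d : ℕ}
    (hd : 3 ≤ d) (hG : ∀ v, (G.neighborSet v).ncard = d) {ε : ℝ} {L : ℕ} (hL : 0 < L)
    (hLε : 4 * (d : ℝ) ≤ ε * L)
    (hbad : ((G.shortCyclePairs (L * L)).ncard : ℝ) ≤ ε / 4 * Nat.card V) :
    (1 - ε) * (((d : ℝ) - 2) * (Nat.card V : ℝ) / 4) ≤ G.genus ∧
      (G.genus : ℝ) ≤ (1 + ε) * (((d : ℝ) - 2) * (Nat.card V : ℝ) / 4) := by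
  have h1 := genus_le_of_regular (by omega) hG
  -- Walk length `L * L` serves both counts: faces need only `L`, components need `L * L`.
  have h2 := le_genus_of_regular (by omega) hG L (L * L) (Nat.le_mul_self L)
  have h3 := mul_card_connectedComponent_le G (fun v => by
    obtain ⟨w, -, hw⟩ := exists_adj_of_regular (by omega : 2 ≤ d) hG v v
    exact ⟨w, hw⟩) (fun u v _ => exists_adj_of_regular (by omega) hG u v) L (L * L) le_rfl
  set n := Nat.card V
  set B := (G.shortCyclePairs (L * L)).ncard
  set c := Nat.card G.ConnectedComponent
  set g := G.genus
  have h1' : 4 * (g : ℝ) + 2 * n ≤ n * d + 2 * c := by exact_mod_cast h1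
  have h2' : (L : ℝ) * (n * d) ≤ L * (4 * g + 2 * n) + 2 * (n * d) + 2 * L * B := by
    exact_mod_cast h2
  have h3' : (L : ℝ) * c ≤ n + L * B := by exact_mod_cast h3
  have hL' : (0 : ℝ) < L := by exact_mod_cast hL
  have hd' : (3 : ℝ) ≤ d := by exact_mod_cast hd
  have hn : (0 : ℝ) ≤ n := Nat.cast_nonneg _
  have hε : 0 < ε := by
    by_contra h
    have : ε * L ≤ 0 := mul_nonpos_of_nonpos_of_nonneg (not_lt.1 h) hL'.le
    linarith
  have hnd : (n : ℝ) * (4 * d) ≤ n * (ε * L) := mul_le_mul_of_nonneg_left hLε hn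
  have hlow : (n : ℝ) * d ≤ 4 * g + 2 * n + ε / 2 * n + 2 * B := by
    refine le_of_mul_le_mul_left ?_ hL'
    linarith
  have hc : (c : ℝ) ≤ ε / 4 * n + B := by
    refine le_of_mul_le_mul_left ?_ hL'
    have : (n : ℝ) ≤ n * d := le_mul_of_one_le_right hn (by linarith)
    linarith
  -- The errors in `4 * g` add up to at most `ε * n`; this is within the allowed error because `d -
  -- 2 ≥ 1`.
  have hεn : ε * n ≤ ε * n * (d - 2) := le_mul_of_one_le_right (by positivity) (by linarith)
  constructor <;> linarith

end SimpleGraph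

/-! ### Existence of regular graphs -/

/-- Connection set of a circulant graph: the `m` nearest steps on either side, and for odd `d` also
the half turn, available because `n` is then even. -/
theorem exists_symmetric_finset {n d : ℕ} (hn : d < n) (he : Even (d * n)) :
    ∃ P : Finset ℕ, P.card = d ∧ ∀ x ∈ P, 0 < x ∧ x < n ∧ n - x ∈ P := by
  obtain ⟨m, rfl | rfl⟩ := Nat.even_or_odd' d
  · refine ⟨Finset.Icc 1 m ∪ Finset.Ico (n - m) n, ?_, ?_⟩
    · rw [Finset.card_union_of_disjoint, Nat.card_Icc, Nat.card_Ico]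
      · omega
      · rw [Finset.disjoint_left]
        simp only [Finset.mem_Icc, Finset.mem_Ico]
        omega
    · simp only [Finset.mem_union, Finset.mem_Icc, Finset.mem_Ico]
      omega
  · obtain ⟨h, rfl⟩ : ∃ h, n = 2 * h := by
      rw [Nat.even_mul] at he
      rcases he with he | he
      · exact absurd he (by simp)
      · exact he.exists_two_nsmul
    refine ⟨insert h (Finset.Icc 1 m ∪ Finset.Ico (2 * h - m) (2 * h)), ?_, ?_⟩
    · rw [Finset.card_insert_of_notMem, Finset.card_union_of_disjoint, Nat.card_Icc, Nat.card_Ico]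
      · omega
      · rw [Finset.disjoint_left]
        simp only [Finset.mem_Icc, Finset.mem_Ico]
        omega
      · simp only [Finset.mem_union, Finset.mem_Icc, Finset.mem_Ico]
        omega
    · simp only [Finset.mem_insert, Finset.mem_union, Finset.mem_Icc, Finset.mem_Ico]
      omega

theorem mem_regularGraphs {n d : ℕ} {G : SimpleGraph (Fin n)} :
    G ∈ regularGraphs n d ↔ ∀ v, (G.neighborSet v).ncard = d := by
  classical
  refine forall_congr' fun v => ?_
  rw [← SimpleGraph.card_neighborSet_eq_degree, ← Nat.card_eq_fintype_card, Nat.card_coe_set_eq]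

theorem regularGraphs_nonempty {n d : ℕ} (hn : d < n) (he : Even (d * n)) :
    (regularGraphs n d).Nonempty := by
  obtain ⟨P, hcard, hP⟩ := exists_symmetric_finset hn he
  have : NeZero n := ⟨by omega⟩
  have hneg : ∀ x : Fin n, x.val ∈ P → (-x).val ∈ P := by
    intro x hx
    obtain ⟨h0, -, h2⟩ := hP _ hx
    rw [Fin.val_neg, if_neg (fun h => by simp [h] at h0)]
    exact h2
  let G : SimpleGraph (Fin n) :=
    { Adj := fun u v => (v - u).val ∈ P
      symm := ⟨fun u v h => by rw [← neg_sub]; exact hneg _ h⟩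
      loopless := ⟨fun u h => by
        rw [sub_self] at h
        exact absurd (hP _ h).1 (by simp)⟩ }
  refine ⟨G, mem_regularGraphs.2 fun u => ?_⟩
  rw [← hcard, ← Set.ncard_coe_finset]
  refine Set.ncard_congr (fun v _ => (v - u).val) (fun v hv => hv) (fun v w _ _ h => ?_)
    fun x hx => ?_
  · exact sub_left_injective (Fin.val_injective h)
  · have hxn := (hP x hx).2.1
    refine ⟨u + ⟨x, hxn⟩, ?_, by simp⟩
    change ((u + ⟨x, hxn⟩ : Fin n) - u).val ∈ P
    simpa using hx

/-! ### Probability estimates and conclusion -/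

theorem regularGraphProb_eq_one {n d : ℕ} {P : SimpleGraph (Fin n) → Prop}
    (hne : (regularGraphs n d).Nonempty) (h : ∀ G ∈ regularGraphs n d, P G) :
    regularGraphProb n d P = 1 := by
  have e : {G ∈ regularGraphs n d | P G} = regularGraphs n d := by
    ext G
    exact ⟨fun hG => hG.1, fun hG => ⟨hG, h G hG⟩⟩
  rw [regularGraphProb, e]
  exact div_self (by exact_mod_cast ((Set.ncard_pos (Set.toFinite _)).2 hne).ne')

theorem regularGraphProb_le_one (n d : ℕ) (P : SimpleGraph (Fin n) → Prop) :
    regularGraphProb n d P ≤ 1 := by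
  refine div_le_one_of_le₀ ?_ (Nat.cast_nonneg _)
  exact_mod_cast Set.ncard_le_ncard (Set.sep_subset (regularGraphs n d) P) (Set.toFinite _)

/-- Markov's inequality for the number of edges on short cycles. -/
theorem le_regularGraphProb {n d k : ℕ} {P : SimpleGraph (Fin n) → Prop} (hd : 0 < d)
    (hne : (regularGraphs n d).Nonempty) (hn : 4 * ((d + 2) * d) + 4 * k < n) {δ : ℝ} (hδ : 0 < δ)
    (h : ∀ G ∈ regularGraphs n d, ((G.shortCyclePairs k).ncard : ℝ) ≤ δ * n → P G) :
    1 - 2 * (d + 1) ^ k * d / δ / n ≤ regularGraphProb n d P := by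
  classical
  set R : Finset (SimpleGraph (Fin n)) := (regularGraphs n d).toFinset with hRdef
  have hmem : ∀ G, G ∈ R ↔ ∀ v, (G.neighborSet v).ncard = d := fun G => by
    rw [hRdef, Set.mem_toFinset, mem_regularGraphs]
  have hnd : n ≤ n * d := Nat.le_mul_of_pos_right n hd
  obtain ⟨m, hm⟩ : ∃ m, m + (2 * ((d + 2) * d) + 2 * k) = n * d := ⟨_, Nat.sub_add_cancel (by omega)⟩
  have hsum := SimpleGraph.mul_sum_ncard_shortCyclePairs_le (V := Fin n) (d := d) (k := k) (m := m)
    (by rw [Nat.card_fin, hm]) R hmem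
  rw [Nat.card_fin] at hsum
  set B : ℕ := ∑ G ∈ R, (G.shortCyclePairs k).ncard
  have hn0 : 0 < n := by omega
  have hB : B ≤ R.card * (2 * (d + 1) ^ k * d) := by
    -- The lower bound on `n` ensures that at least half of the `n * d` oriented edges are
    -- switchable, that is `n * d ≤ 2 * m`.
    have h1 : n * d * B ≤ 2 * (m * B) := by
      rw [← mul_assoc]
      exact Nat.mul_le_mul_right _ (by omega)
    refine Nat.le_of_mul_le_mul_left (h1.trans ?_) (Nat.mul_pos hn0 hd)
    calc 2 * (m * B) ≤ 2 * (R.card * (n * (d + 1) ^ k * (d * d))) := Nat.mul_le_mul_left _ hsum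
      _ = _ := by ring
  have hn0' : (0 : ℝ) < n := by exact_mod_cast hn0
  let Q : Finset (SimpleGraph (Fin n)) := R.filter fun G => ¬ P G
  have hQ : (Q.card : ℝ) * (δ * n) ≤ B := by
    rw [← nsmul_eq_mul]
    calc Q.card • (δ * (n : ℝ)) ≤ ∑ G ∈ Q, ((G.shortCyclePairs k).ncard : ℝ) := by
          refine Finset.card_nsmul_le_sum _ _ _ fun G hG => ?_
          obtain ⟨hGR, hGP⟩ := Finset.mem_filter.1 hG
          by_contra hlt
          exact hGP (h G (Set.mem_toFinset.1 hGR) (not_le.1 hlt).le)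
      _ ≤ ∑ G ∈ R, ((G.shortCyclePairs k).ncard : ℝ) :=
          Finset.sum_le_sum_of_subset_of_nonneg (Finset.filter_subset _ _) fun _ _ _ => by positivity
      _ = B := by simp [B]
  have hB' : (B : ℝ) ≤ R.card * (2 * (d + 1) ^ k * d) := by exact_mod_cast hB
  have hcard : (R.filter P).card + Q.card = R.card := Finset.card_filter_add_card_filter_not _
  have hRpos : (0 : ℝ) < R.card := by
    have : R.Nonempty := Set.toFinset_nonempty.2 hne
    exact_mod_cast this.card_pos
  have e1 : (regularGraphs n d).ncard = R.card := Set.ncard_eq_toFinset_card' _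
  have e2 : {G ∈ regularGraphs n d | P G}.ncard = (R.filter P).card := by
    rw [← Set.ncard_coe_finset]
    congr 1
    ext G
    simp [R]
  rw [regularGraphProb, e1, e2, le_div_iff₀ hRpos, sub_mul, one_mul]
  have hcard' : ((R.filter P).card : ℝ) + Q.card = R.card := by exact_mod_cast hcard
  have hQ' : (Q.card : ℝ) ≤ 2 * (d + 1) ^ k * d / δ / n * R.card := by
    rw [div_div, div_mul_eq_mul_div, le_div_iff₀ (by positivity)]
    linarith
  linarith

theorem theorem2 (d : ℕ) (hd : 2 ≤ d) (ε : ℝ) (hε : 0 < ε) :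
    Tendsto
      (fun n : ℕ => regularGraphProb n d (fun G =>
        (1 - ε) * (((d : ℝ) - 2) * (n : ℝ) / 4) ≤ (G.genus : ℝ) ∧
        (G.genus : ℝ) ≤ (1 + ε) * (((d : ℝ) - 2) * (n : ℝ) / 4)))
      (atTop ⊓ 𝓟 {n : ℕ | Even (d * n)}) (𝓝 1) := by
  have hne : ∀ᶠ n : ℕ in atTop ⊓ 𝓟 {n : ℕ | Even (d * n)}, (regularGraphs n d).Nonempty := by
    rw [eventually_inf_principal]
    filter_upwards [eventually_gt_atTop d] with n hn he using regularGraphs_nonempty hn he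
  -- For `d = 2` the interval shrinks to 0 and leaves no room for error, so the exact genus is
  -- needed.
  rcases hd.eq_or_lt with rfl | hd3
  · refine tendsto_const_nhds.congr' ?_
    filter_upwards [hne, (eventually_gt_atTop 0).filter_mono inf_le_left] with n hn hn0
    refine (regularGraphProb_eq_one hn fun G hG => ?_).symm
    have : Nonempty (Fin n) := ⟨⟨0, hn0⟩⟩
    rw [SimpleGraph.genus_eq_zero_of_two_regular (mem_regularGraphs.1 hG)]
    simp
  · obtain ⟨L, hL⟩ := exists_nat_ge (4 * (d : ℝ) / ε)
    have hLε : 4 * (d : ℝ) ≤ ε * L := by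
      rw [div_le_iff₀ hε] at hL
      linarith
    have hL0 : 0 < L := by
      rcases Nat.eq_zero_or_pos L with rfl | h
      · have : (0 : ℝ) < d := by exact_mod_cast (by omega : 0 < d)
        simp only [Nat.cast_zero, mul_zero] at hLε
        linarith
      · exact h
    have hlim : Tendsto (fun n : ℕ => 1 - 2 * ((d : ℝ) + 1) ^ (L * L) * d / (ε / 4) / n)
        (atTop ⊓ 𝓟 {n : ℕ | Even (d * n)}) (𝓝 1) := by
      have := (tendsto_const_div_atTop_nhds_zero_nat
        (2 * ((d : ℝ) + 1) ^ (L * L) * d / (ε / 4))).const_sub 1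
      rw [sub_zero] at this
      exact this.mono_left inf_le_left
    refine tendsto_of_tendsto_of_tendsto_of_le_of_le' hlim tendsto_const_nhds ?_
      (Eventually.of_forall fun n => regularGraphProb_le_one n d _)
    filter_upwards [hne, (eventually_gt_atTop (4 * ((d + 2) * d) + 4 * (L * L))).filter_mono
      inf_le_left] with n hn hlarge
    refine le_regularGraphProb (by omega) hn hlarge (by positivity) fun G hG hbad => ?_
    have : Nonempty (Fin n) := ⟨⟨0, by omega⟩⟩
    have := SimpleGraph.genus_bounds_of_regular hd3 (mem_regularGraphs.1 hG) hL0 hLε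
      (by rwa [Nat.card_fin])
    rwa [Nat.card_fin] at this
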